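/- **Conventions.** Circuits are non-uniform circuits over a fixed universal gate set ($X$, $H$, $T$, CNOT, Toffoli) together with creation of ancilla qubits in state $|0\rangle$, computational-basis measurements and discarding of qubits; size is the total number of these operations, and a family of circuits indexed by $\lambda\in\mathbb N_+$ is efficient if its size is at most a polynomial in $\lambda$. A function $f:\mathbb N_+\to\mathbb R$ is negligible if $p(\lambda)f(\lambda)\to0$ for every polynomial $p$. An efficient LOCC family is a family of two-party protocols of polynomial total size, in which Alice and Bob alternately apply circuits to their own qubits (input and ancillas) and a communication register that is measured after each turn. Write $|\Phi\rangle=\frac1{\sqrt2}(|00\rangle+|11\rangle)$. For an LOCC map $\Gamma$ with output on $m+m$ qubits, $p_{err}(\Gamma,\rho)=1-\langle\Phi^{\otimes m}|\Gamma(\rho)|\Phi^{\otimes m}\rangle$. The one-shot distillable entanglement $E_D^{\varepsilon}(\rho)$ is the supremum of all $m$ for which some LOCC map $\Gamma$ has $p_{err}(\Gamma,\rho)\le\varepsilon$. For $\varepsilon:\mathbb N_+\to[0,1]$, a function $m:\mathbb N_+\to\mathbb N$ is a valid lower bound on the computational distillable entanglement of $\{\rho^\lambda\}$ with error $\varepsilon$,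 written $\hat E^{\varepsilon}_D(\{\rho^\lambda\})\ge m$, if there is an efficient LOCC family $\{\hat\Gamma^\lambda\}$ with output on $m(\lambda)+m(\lambda)$ qubits and $p_{err}(\hat\Gamma^\lambda,\rho^\lambda)\le\varepsilon(\lambda)$ for all $\lambda$. A *NISBQ scheme* is a family of channels $C_{\lambda,n}$ from $n$ qubits to $\ell(\lambda,n)$ qubits, computed by circuits of size $\mathrm{poly}(\lambda,n)$, such that (i) there are channels $D_{\lambda,n}$ (not necessarily efficient) such that for every polynomially bounded $n=n(\lambda)$ the diamond-norm distance between $D_{\lambda,n}\circ C_{\lambda,n}$ and the identity channel on $n$ qubits is negligible in $\lambda$; (ii) for every polynomially bounded $n=n(\lambda)$, no efficient quantum algorithm with black-box access to a channel distinguishes $C_{\lambda,n}$ from the channel $C^0_{\lambda,n}$, which discards its input and applies $C_{\lambda,n}$ to $|0^n\rangle$, with more than negligible advantage. **Statement.** Let $\{C_{\lambda,n}\}$ be a NISBQ scheme, let $n:\mathbb N_+\to\mathbb N$ be polynomially bounded, and let $\rho^\lambda=(\mathrm{id}_A\otimes C_{\lambda,n(\lambda)})(\Phi^{\otimes n(\lambda)})$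 be the bipartite (in general mixed) state on $n(\lambda)$ qubits on side $A$ and $\ell(\lambda,n(\lambda))$ qubits on side $B$ obtained from $n(\lambda)$ EPR pairs by applying the commitment channel to the $B$ halves. Then $\{\rho^\lambda\}$ is a family of density operators that can be prepared exactly by an efficient family of circuits, and: 1. There is a negligible function $\delta:\mathbb N_+\to[0,1]$ such that $E_D^{\delta(\lambda)}(\rho^\lambda)\ge n(\lambda)$ for all $\lambda$, with equality for all sufficiently large $\lambda$. Moreover $E_D^{\varepsilon}(\rho^\lambda)\le n(\lambda)$ for all $\lambda$ and all $\varepsilon<1/2$. 2. For all $\varepsilon:\mathbb N_+\to[0,1]$ and $m:\mathbb N_+\to\mathbb N$ with $\hat E^{\varepsilon}_D(\{\rho^\lambda\})\ge m$, there is a negligible function $\mathsf{negl}$ such that $m(\lambda)\,\bigl(1-\varepsilon(\lambda)-2^{-m(\lambda)}\bigr)\le\mathsf{negl}(\lambda)$ for all $\lambda$. In particular, if there is a polynomial $p$, positive on $\mathbb N_+$, such that for all sufficiently large $\lambda$ with $m(\lambda)>0$ one has $1-\varepsilon(\lambda)\ge 2^{-m(\lambda)}+1/p(\lambda)$, then $m(\lambda)=0$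 for all sufficiently large $\lambda$. -/

import Mathlib

open Filter Topology
open scoped ENNReal Matrix ComplexOrder

noncomputable section

namespace CompEnt

/-! ### Operators, channels, LOCC maps -/

/-- Linear operators on the finite-dimensional Hilbert space `ℂ^a`. -/
abbrev Op (a : Type) : Type := Matrix a a ℂ

/-- `E ⊗ id` on `ℂ^a ⊗ ℂ^b`. -/
def mapA {a a' : Type} (b : Type) (E : Op a →ₗ[ℂ] Op a') : Op (a × b) →ₗ[ℂ] Op (a' × b) where
  toFun X := Matrix.of fun p q => E (Matrix.of fun i j => X (i, p.2) (j, q.2)) p.1 q.1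
  map_add' X Y := by
    ext p q
    have h : (Matrix.of fun i j => (X + Y) (i, p.2) (j, q.2)) =
        (Matrix.of fun i j => X (i, p.2) (j, q.2)) +
          (Matrix.of fun i j => Y (i, p.2) (j, q.2)) := by
      ext i j; simp
    exact (congrArg (fun Z => E Z p.1 q.1) h).trans (by rw [map_add]; rfl)
  map_smul' c X := by
    ext p q
    have h : (Matrix.of fun i j => (c • X) (i, p.2) (j, q.2)) =
        c • (Matrix.of fun i j => X (i, p.2) (j, q.2)) := by
      ext i j; simp
    exact (congrArg (fun Z => E Z p.1 q.1) h).trans (by rw [map_smul]; rfl)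

/-- `id ⊗ E` on `ℂ^a ⊗ ℂ^b`. -/
def mapB (a : Type) {b b' : Type} (E : Op b →ₗ[ℂ] Op b') : Op (a × b) →ₗ[ℂ] Op (a × b') where
  toFun X := Matrix.of fun p q => E (Matrix.of fun i j => X (p.1, i) (q.1, j)) p.2 q.2
  map_add' X Y := by
    ext p q
    have h : (Matrix.of fun i j => (X + Y) (p.1, i) (q.1, j)) =
        (Matrix.of fun i j => X (p.1, i) (q.1, j)) +
          (Matrix.of fun i j => Y (p.1, i) (q.1, j)) := by
      ext i j; simp
    exact (congrArg (fun Z => E Z p.2 q.2) h).trans (by rw [map_add]; rfl)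
  map_smul' c X := by
    ext p q
    have h : (Matrix.of fun i j => (c • X) (p.1, i) (q.1, j)) =
        c • (Matrix.of fun i j => X (p.1, i) (q.1, j)) := by
      ext i j; simp
    exact (congrArg (fun Z => E Z p.2 q.2) h).trans (by rw [map_smul]; rfl)

/-- Complete positivity. -/
def IsCP {a b : Type} (E : Op a →ₗ[ℂ] Op b) : Prop :=
  ∀ (k : ℕ) (X : Op (Fin k × a)), X.PosSemidef → (mapB (Fin k) E X).PosSemidef

/-- Quantum channels: completely positive trace-preserving maps. -/
def IsChannel {a b : Type} [Fintype a] [Fintype b] (E : Op a →ₗ[ℂ] Op b) : Prop :=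
  IsCP E ∧ ∀ X, (E X).trace = X.trace

/-- Density operators. -/
def IsDensity {a : Type} [Fintype a] (X : Op a) : Prop :=
  X.PosSemidef ∧ X.trace = 1

/-- The trace norm: the sum of the singular values. -/
def traceNorm {a b : Type} [Fintype a] [Fintype b] [DecidableEq b] (X : Matrix a b ℂ) : ℝ :=
  ∑ i, √((Matrix.isHermitian_conjTranspose_mul_self X).eigenvalues i)

/-- The diamond norm `sup {‖(id ⊗ E) X‖₁ : ‖X‖₁ ≤ 1}`, where the ancilla has the dimension of the
input system of `E`. -/
def diamondNorm {a b : Type} [Fintype a] [Fintype b] [DecidableEq a] [DecidableEq b]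
    (E : Op a →ₗ[ℂ] Op b) : ℝ≥0∞ :=
  ⨆ (X : Op (a × a)) (_ : traceNorm X ≤ 1), ENNReal.ofReal (traceNorm (mapB a E X))

/-- LOCC maps `A ⊗ B → A' ⊗ B'`: finite protocols in which, at every step, one party applies an
arbitrary quantum operation with a classical outcome `k` (an instrument: completely positive maps
`E k` whose sum preserves the trace), sends `k` to the other party, and the rest of the protocol
may depend on `k`. -/
inductive IsLOCC {a' b' : Type} [Fintype a'] [Fintype b'] :
    ∀ {a b : Type} [Fintype a] [Fintype b], (Op (a × b) →ₗ[ℂ] Op (a' × b')) → Prop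
  | done : IsLOCC (a := a') (b := b') LinearMap.id
  | alice {a b a₁ : Type} [Fintype a] [Fintype b] [Fintype a₁] (K : ℕ)
      (E : Fin K → (Op a →ₗ[ℂ] Op a₁)) (hcp : ∀ k, IsCP (E k))
      (htp : ∀ X, ∑ k, (E k X).trace = X.trace)
      (Γ : Fin K → (Op (a₁ × b) →ₗ[ℂ] Op (a' × b'))) (hΓ : ∀ k, IsLOCC (Γ k)) :
      IsLOCC (∑ k, Γ k ∘ₗ mapA b (E k))
  | bob {a b b₁ : Type} [Fintype a] [Fintype b] [Fintype b₁] (K : ℕ)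
      (E : Fin K → (Op b →ₗ[ℂ] Op b₁)) (hcp : ∀ k, IsCP (E k))
      (htp : ∀ X, ∑ k, (E k X).trace = X.trace)
      (Γ : Fin K → (Op (a × b₁) →ₗ[ℂ] Op (a' × b'))) (hΓ : ∀ k, IsLOCC (Γ k)) :
      IsLOCC (∑ k, Γ k ∘ₗ mapB a (E k))

/-! ### Qubit registers -/

/-- Operators on a register of qubits labelled by `ι`; the computational basis is `ι → Bool`. -/
abbrev QOp (ι : Type) : Type := Op (ι → Bool)

/-- A register `ι ⊕ κ` as a bipartite system. -/
def bip (ι κ : Type) : QOp (ι ⊕ κ) ≃ₗ[ℂ] Op ((ι → Bool) × (κ → Bool)) :=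
  Matrix.reindexLinearEquiv ℂ ℂ (Equiv.sumArrowEquivProdArrow ι κ Bool)
    (Equiv.sumArrowEquivProdArrow ι κ Bool)

/-- Apply `E` to the second part of the register `ι ⊕ κ`. -/
def onB (ι : Type) {κ κ' : Type} (E : QOp κ →ₗ[ℂ] QOp κ') : QOp (ι ⊕ κ) →ₗ[ℂ] QOp (ι ⊕ κ') :=
  (bip ι κ').symm.toLinearMap ∘ₗ mapB (ι → Bool) E ∘ₗ (bip ι κ).toLinearMap

/-- The operator `|0…0⟩⟨0…0|`. -/
def zeroState (ι : Type) : QOp ι :=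
  open Classical in
  Matrix.of fun x y => if (∀ i, x i = false) ∧ (∀ i, y i = false) then 1 else 0

/-- Place the qubits `ι` at the positions `f` of the register `κ`, all other qubits of which are
initialized in the state `|0⟩`. -/
def initReg {ι κ : Type} (f : ι ↪ κ) : QOp ι →ₗ[ℂ] QOp κ where
  toFun X := open Classical in Matrix.of fun x y =>
    if (∀ j, j ∉ Set.range f → x j = false) ∧ (∀ j, j ∉ Set.range f → y j = false)
    then X (x ∘ f) (y ∘ f) else 0
  map_add' X Y := by
    ext x y
    simp only [Matrix.of_apply, Matrix.add_apply]
    split_ifs <;> simp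
  map_smul' c X := by
    ext x y
    simp only [Matrix.of_apply, Matrix.smul_apply, RingHom.id_apply]
    split_ifs <;> simp

/-- Keep the qubits at the positions `f` of the register `κ` and trace out all others. -/
def reduceReg {ι κ : Type} [Fintype κ] [DecidableEq κ] (f : ι ↪ κ) : QOp κ →ₗ[ℂ] QOp ι where
  toFun X := open Classical in Matrix.of fun u v => ∑ x : κ → Bool, ∑ y : κ → Bool,
    if x ∘ f = u ∧ y ∘ f = v ∧ (∀ j, j ∉ Set.range f → x j = y j) then X x y else 0
  map_add' X Y := by
    ext u v
    simp only [Matrix.of_apply, Matrix.add_apply, ← Finset.sum_add_distrib]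
    refine Finset.sum_congr rfl fun x _ => Finset.sum_congr rfl fun y _ => ?_
    split_ifs <;> simp
  map_smul' c X := by
    ext u v
    simp only [Matrix.of_apply, Matrix.smul_apply, RingHom.id_apply, Finset.smul_sum]
    refine Finset.sum_congr rfl fun x _ => Finset.sum_congr rfl fun y _ => ?_
    split_ifs <;> simp

/-! ### Circuits -/

/-- Elementary operations on the qubits `ι`: the gates `X`, `H`, `T = diag(1, e^{iπ/4})`, `CNOT`
(control, target), the Toffoli gate (controls, target), and the measurement of a qubit in the
computational basis. -/
inductive Gate (ι : Type) : Type
  | x (i : ι)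
  | h (i : ι)
  | t (i : ι)
  | cnot (i j : ι) (hij : i ≠ j)
  | toffoli (i j k : ι) (hij : i ≠ j) (hik : i ≠ k) (hjk : j ≠ k)
  | meas (i : ι)

/-- Relabel the qubits. -/
def Gate.map {ι κ : Type} (f : ι ↪ κ) : Gate ι → Gate κ
  | .x i => .x (f i)
  | .h i => .h (f i)
  | .t i => .t (f i)
  | .cnot i j hij => .cnot (f i) (f j) (f.injective.ne hij)
  | .toffoli i j k hij hik hjk =>
      .toffoli (f i) (f j) (f k) (f.injective.ne hij) (f.injective.ne hik) (f.injective.ne hjk)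
  | .meas i => .meas (f i)

/-- The permutation matrix of a map `g` of the computational basis, `|y⟩ ↦ |g y⟩`. -/
def basisMap {ι : Type} [DecidableEq ι] [Fintype ι] (g : (ι → Bool) → (ι → Bool)) : QOp ι :=
  Matrix.of fun x y => if x = g y then 1 else 0

/-- The Hadamard gate on the qubit `i`. -/
def hadamard {ι : Type} [DecidableEq ι] [Fintype ι] (i : ι) : QOp ι :=
  Matrix.of fun x y =>
    if ∀ j, j ≠ i → x j = y j then ((1 / √2 : ℝ) : ℂ) * (if x i && y i then -1 else 1) else 0

/-- The `T` gate on the qubit `i`. -/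
def tGate {ι : Type} [DecidableEq ι] [Fintype ι] (i : ι) : QOp ι :=
  Matrix.diagonal fun x => if x i then Complex.exp (Real.pi / 4 * Complex.I) else 1

/-- Conjugation `X ↦ U X U†`. -/
def conjBy {a : Type} [Fintype a] (U : Op a) : Op a →ₗ[ℂ] Op a where
  toFun X := U * X * Uᴴ
  map_add' X Y := by rw [mul_add, add_mul]
  map_smul' c X := by simp

/-- Measurement of the qubit `i` in the computational basis, the outcome being left in the
register. -/
def measure {ι : Type} (i : ι) : QOp ι →ₗ[ℂ] QOp ι where
  toFun X := Matrix.of fun x y => if x i = y i then X x y else 0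
  map_add' X Y := by
    ext x y
    simp only [Matrix.of_apply, Matrix.add_apply]
    split_ifs <;> simp
  map_smul' c X := by
    ext x y
    simp only [Matrix.of_apply, Matrix.smul_apply, RingHom.id_apply]
    split_ifs <;> simp

/-- The action of an elementary operation on operators. -/
def Gate.run {ι : Type} [DecidableEq ι] [Fintype ι] : Gate ι → (QOp ι →ₗ[ℂ] QOp ι)
  | .x i => conjBy (basisMap fun x => Function.update x i (!x i))
  | .h i => conjBy (hadamard i)
  | .t i => conjBy (tGate i)
  | .cnot i j _ => conjBy (basisMap fun x => Function.update x j (xor (x j) (x i)))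
  | .toffoli i j k _ _ _ =>
      conjBy (basisMap fun x => Function.update x k (xor (x k) (x i && x j)))
  | .meas i => measure i

/-- A circuit: the list of its elementary operations, in the order in which they are applied. -/
abbrev Circuit (ι : Type) : Type := List (Gate ι)

/-- The action of a circuit on operators. -/
def Circuit.run {ι : Type} [DecidableEq ι] [Fintype ι] : Circuit ι → (QOp ι →ₗ[ℂ] QOp ι)
  | [] => LinearMap.id
  | g :: c => Circuit.run c ∘ₗ g.run

/-- A circuit that computes a channel from the qubits `ι` to the qubits `κ`: it creates `anc`
ancilla qubits in the state `|0⟩`, applies the elementary operations, outputs the qubits `out` and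
discards the others. -/
structure ChannelCircuit (ι κ : Type) where
  anc : ℕ
  circ : Circuit (ι ⊕ Fin anc)
  out : κ ↪ ι ⊕ Fin anc

/-- The number of elementary operations, including the creation of ancillas. -/
def ChannelCircuit.size {ι κ : Type} (c : ChannelCircuit ι κ) : ℕ := c.anc + c.circ.length

/-- The channel computed by a circuit. -/
def ChannelCircuit.run {ι κ : Type} [DecidableEq ι] [Fintype ι] (c : ChannelCircuit ι κ) :
    QOp ι →ₗ[ℂ] QOp κ :=
  reduceReg c.out ∘ₗ Circuit.run c.circ ∘ₗ initReg Function.Embedding.inl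

/-! ### Asymptotics -/

/-- `f` is bounded by a polynomial in the security parameter. -/
def PolyBounded (f : ℕ+ → ℕ) : Prop :=
  ∃ p : Polynomial ℕ, ∀ lam : ℕ+, f lam ≤ p.eval (lam : ℕ)

/-- `f` goes to zero faster than any inverse polynomial. -/
def Negligible (f : ℕ+ → ℝ) : Prop :=
  ∀ p : Polynomial ℝ, Tendsto (fun lam : ℕ+ => p.eval ((lam : ℕ) : ℝ) * f lam) atTop (𝓝 0)

/-- `m` is asymptotically at most `n`: `m lam ≤ n lam` for all large enough `lam`. -/
def AsympLE (m n : ℕ+ → ℕ) : Prop :=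
  ∃ lam₀ : ℕ+, ∀ lam, lam₀ ≤ lam → m lam ≤ n lam

/-- The family of states `ρ lam` is prepared by circuits of polynomial size, from no input. -/
def EfficientlyPreparable {κ : ℕ+ → Type} (ρ : ∀ lam, QOp (κ lam)) : Prop :=
  ∃ c : ∀ lam, ChannelCircuit (Fin 0) (κ lam),
    PolyBounded (fun lam => (c lam).size) ∧ ∀ lam, (c lam).run (zeroState (Fin 0)) = ρ lam

/-! ### Distillable entanglement -/

/-- The vector `|Φ⟩^{⊗ m}`, `|Φ⟩ = (|00⟩ + |11⟩)/√2`, the `i`-th pair consisting of the qubits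
`inl i` (on side `A`) and `inr i` (on side `B`). -/
def eprVec (m : ℕ) : (Fin m ⊕ Fin m → Bool) → ℂ := fun x =>
  ∏ i : Fin m, if x (Sum.inl i) = x (Sum.inr i) then ((1 / √2 : ℝ) : ℂ) else 0

/-- The maximally entangled state `Φ^{⊗ m}`. -/
def epr (m : ℕ) : QOp (Fin m ⊕ Fin m) := Matrix.vecMulVec (eprVec m) (star (eprVec m))

/-- The distillation error `1 - ⟨Φ^{⊗ m}| Γ(ρ) |Φ^{⊗ m}⟩`. -/
def pErr {ι : Type} {m : ℕ} (Γ : QOp ι →ₗ[ℂ] QOp (Fin m ⊕ Fin m)) (ρ : QOp ι) : ℝ :=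
  1 - (star (eprVec m) ⬝ᵥ (Γ ρ *ᵥ eprVec m)).re

/-- The one-shot distillable entanglement `E_D^ε(ρ)`. -/
def distillable {nA nB : ℕ} (ε : ℝ) (ρ : QOp (Fin nA ⊕ Fin nB)) : ℕ∞ :=
  ⨆ (m : ℕ) (_ : ∃ Γ : Op ((Fin nA → Bool) × (Fin nB → Bool)) →ₗ[ℂ]
        Op ((Fin m → Bool) × (Fin m → Bool)), IsLOCC Γ ∧
      pErr ((bip (Fin m) (Fin m)).symm.toLinearMap ∘ₗ Γ ∘ₗ (bip (Fin nA) (Fin nB)).toLinearMap) ρ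
        ≤ ε), (m : ℕ∞)

/-- A circuit description of an LOCC map from `nA + nB` to `mA + mB` qubits: `r` rounds, ancilla
registers of `tA` and `tB` qubits, a communication register of `c` qubits. -/
structure LOCCCircuit (nA nB mA mB : ℕ) where
  tA : ℕ
  tB : ℕ
  c : ℕ
  r : ℕ
  circA : Fin r → Circuit (Fin (nA + tA) ⊕ Fin c)
  circB : Fin r → Circuit (Fin (nB + tB) ⊕ Fin c)
  hA : mA ≤ nA + tA
  hB : mB ≤ nB + tB

namespace LOCCCircuit

variable {nA nB mA mB : ℕ} (Γ : LOCCCircuit nA nB mA mB)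

/-- All qubits: Alice's, Bob's, and the communication register. -/
abbrev Reg : Type := (Fin (nA + Γ.tA) ⊕ Fin (nB + Γ.tB)) ⊕ Fin Γ.c

/-- Alice's qubits and the communication register. -/
def embA : Fin (nA + Γ.tA) ⊕ Fin Γ.c ↪ Γ.Reg :=
  Function.Embedding.sumMap Function.Embedding.inl (Function.Embedding.refl _)

/-- Bob's qubits and the communication register. -/
def embB : Fin (nB + Γ.tB) ⊕ Fin Γ.c ↪ Γ.Reg :=
  Function.Embedding.sumMap Function.Embedding.inr (Function.Embedding.refl _)

/-- The input is placed on the first `nA` qubits of Alice and the first `nB` qubits of Bob. -/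
def inp : Fin nA ⊕ Fin nB ↪ Γ.Reg :=
  (Function.Embedding.sumMap (Fin.castAddEmb Γ.tA)
    (Fin.castAddEmb Γ.tB)).trans Function.Embedding.inl

/-- The output is read from the first `mA` qubits of Alice and the first `mB` qubits of Bob. -/
def out : Fin mA ⊕ Fin mB ↪ Γ.Reg :=
  (Function.Embedding.sumMap (Fin.castLEEmb Γ.hA)
    (Fin.castLEEmb Γ.hB)).trans Function.Embedding.inl

/-- Measurement of the communication register. -/
def measC : Circuit Γ.Reg := (List.finRange Γ.c).map fun i => Gate.meas (Sum.inr i)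

/-- All the operations of the protocol, in order. -/
def circuit : Circuit Γ.Reg :=
  (List.finRange Γ.r).flatMap fun i =>
    (Γ.circA i).map (Gate.map Γ.embA) ++ Γ.measC ++ (Γ.circB i).map (Gate.map Γ.embB) ++ Γ.measC

/-- Number of elementary operations, including ancilla creation and measurements. -/
def size : ℕ := Γ.tA + Γ.tB + Γ.c + Γ.circuit.length

/-- The map implemented by the protocol. -/
def run : QOp (Fin nA ⊕ Fin nB) →ₗ[ℂ] QOp (Fin mA ⊕ Fin mB) :=
  reduceReg Γ.out ∘ₗ Circuit.run Γ.circuit ∘ₗ initReg Γ.inp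

end LOCCCircuit

/-- `m` is a valid lower bound on the computational distillable entanglement, with error `ε`, of
the family `ρ`. -/
def CompDistillableGE (ε : ℕ+ → ℝ) {nA nB : ℕ+ → ℕ}
    (ρ : ∀ lam, QOp (Fin (nA lam) ⊕ Fin (nB lam))) (m : ℕ+ → ℕ) : Prop :=
  ∃ Γ : ∀ lam, LOCCCircuit (nA lam) (nB lam) (m lam) (m lam),
    PolyBounded (fun lam => (Γ lam).size) ∧ ∀ lam, pErr (Γ lam).run (ρ lam) ≤ ε lam

/-! ### Commitments to quantum messages -/

/-- An oracle circuit with black-box access to a channel from `n` to `l` qubits. It has a memory of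
`w + 1` qubits, initially `|0…0⟩`, and makes `q` queries. For the `i`-th query it creates `n` qubits
in the state `|0…0⟩`, applies the circuit `pre i` to the memory and these `n` qubits, submits the
latter to the oracle, applies the circuit `post i` to the memory and the `l` qubits of the answer,
and discards the latter. At the end it measures the memory qubit `0` and accepts on outcome `1`. -/
structure OracleCircuit (n l : ℕ) where
  w : ℕ
  q : ℕ
  pre : Fin q → Circuit (Fin (w + 1) ⊕ Fin n)
  post : Fin q → Circuit (Fin (w + 1) ⊕ Fin l)

namespace OracleCircuit

variable {n l : ℕ} (𝒜 : OracleCircuit n l)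

/-- Number of elementary operations, where a query costs the number of qubits it involves. -/
def size : ℕ :=
  𝒜.w + 2 + ∑ i, ((𝒜.pre i).length + (𝒜.post i).length + n + l + 1)

/-- The operations around the `i`-th query to the oracle `O`. -/
def round (O : QOp (Fin n) →ₗ[ℂ] QOp (Fin l)) (i : Fin 𝒜.q) :
    QOp (Fin (𝒜.w + 1)) →ₗ[ℂ] QOp (Fin (𝒜.w + 1)) :=
  reduceReg Function.Embedding.inl ∘ₗ Circuit.run (𝒜.post i) ∘ₗ onB (Fin (𝒜.w + 1)) O ∘ₗ
    Circuit.run (𝒜.pre i) ∘ₗ initReg Function.Embedding.inl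

/-- The final state of the memory. -/
def finalState (O : QOp (Fin n) →ₗ[ℂ] QOp (Fin l)) : QOp (Fin (𝒜.w + 1)) :=
  (List.finRange 𝒜.q).foldl (fun X i => 𝒜.round O i X) (zeroState (Fin (𝒜.w + 1)))

/-- The probability of acceptance with oracle `O`. -/
def acceptProb (O : QOp (Fin n) →ₗ[ℂ] QOp (Fin l)) : ℝ :=
  ∑ x : Fin (𝒜.w + 1) → Bool, if x 0 then (𝒜.finalState O x x).re else 0

end OracleCircuit

/-- A family of channels given by circuits, `n` qubits being mapped to `outLen lam n` qubits. -/
structure CommitmentFamily where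
  outLen : ℕ+ → ℕ → ℕ
  circ : ∀ (lam : ℕ+) (n : ℕ), ChannelCircuit (Fin n) (Fin (outLen lam n))

namespace CommitmentFamily

variable (S : CommitmentFamily)

/-- The channel `C_{lam, n}`. -/
def C (lam : ℕ+) (n : ℕ) : QOp (Fin n) →ₗ[ℂ] QOp (Fin (S.outLen lam n)) := (S.circ lam n).run

/-- The channel that discards its input and applies `C_{lam, n}` to `|0^n⟩`. -/
def C0 (lam : ℕ+) (n : ℕ) : QOp (Fin n) →ₗ[ℂ] QOp (Fin (S.outLen lam n)) :=
  (Matrix.traceLinearMap (Fin n → Bool) ℂ ℂ).smulRight (S.C lam n (zeroState (Fin n)))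

/-- Non-interactive statistically binding commitments for quantum messages. -/
structure IsNISBQ : Prop where
  /-- The channels have circuits of size polynomial in `lam` and `n`. -/
  efficient : ∃ p : Polynomial ℕ, ∀ (lam : ℕ+) (n : ℕ),
    (S.circ lam n).size ≤ p.eval ((lam : ℕ) + n)
  /-- There is an approximate inverse channel, up to a negligible diamond distance. -/
  binding : ∃ D : ∀ (lam : ℕ+) (n : ℕ), QOp (Fin (S.outLen lam n)) →ₗ[ℂ] QOp (Fin n),
    (∀ lam n, IsChannel (D lam n)) ∧
    ∀ n : ℕ+ → ℕ, PolyBounded n → ∃ δ : ℕ+ → ℝ, Negligible δ ∧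
      ∀ lam, diamondNorm (D lam (n lam) ∘ₗ S.C lam (n lam) - LinearMap.id)
        ≤ ENNReal.ofReal (δ lam)
  /-- Efficient algorithms with black-box access cannot distinguish `C` from `C0`. -/
  indistinguishable : ∀ n : ℕ+ → ℕ, PolyBounded n →
    ∀ 𝒜 : ∀ lam, OracleCircuit (n lam) (S.outLen lam (n lam)),
      PolyBounded (fun lam => (𝒜 lam).size) →
      Negligible fun lam => |(𝒜 lam).acceptProb (S.C lam (n lam))
        - (𝒜 lam).acceptProb (S.C0 lam (n lam))|

/-- The state obtained from `n lam` EPR pairs by committing to the `B` register. -/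
def state (n : ℕ+ → ℕ) (lam : ℕ+) : QOp (Fin (n lam) ⊕ Fin (S.outLen lam (n lam))) :=
  onB (Fin (n lam)) (S.C lam (n lam)) (epr (n lam))

end CommitmentFamily

end CompEnt

end

set_option linter.unusedSectionVars false

noncomputable section

namespace CompEnt

/-! ### Slices of operators on registers -/

section Slices

variable {ι κ τ : Type}

/-! Information-theoretic part. Bob can apply the decoder $D$ to his side. Since $D\circ C$ is close
to the identity in diamond norm and $\Phi^{\otimes n}$ has trace norm 1, the fidelity with
$\Phi^{\otimes n}$ drops by at most the binding error (`le_distillable_of_channel`). Conversely,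
every state whose $A$ side has $n$ qubits is a sum of unnormalised pure states of Schmidt rank at
most $2^n$. Local completely positive maps preserve this cone (`IsLOCC.mem_schmidtCone`). A vector
of Schmidt rank at most $k$ corresponds to a matrix $M$ of rank at most $k$, and its overlap with
$\sum_i|ii\rangle$ is $|\mathrm{tr}\,M|^2\le k\,\mathrm{tr}\,M^\dagger M$. So the fidelity with
$\Phi^{\otimes m}$ is at most $2^{n-m}$, which excludes $m>n$ for errors below $1/2$
(`distillable_le`).

Computational part. An efficient protocol yields a one-query distinguisher (`exists_oracleCircuit`).
It prepares EPR pairs, sends halves to the oracle, simulates both parties, and tests for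
$\Phi^{\otimes m}$ by undoing the EPR preparation and checking that all qubits are 0. It accepts
with probability equal to the fidelity of the protocol. With the oracle $C^0$ the shared state is a
product state. A circuit protocol keeps it separable, so the acceptance probability is at most
$2^{-m}$ (`LOCCCircuit.le_pErr_of_product`). With $C$ it is at least $1-\varepsilon$. Hence
$1-\varepsilon-2^{-m}$ is bounded by a negligible advantage, and the polynomially bounded factor $m$
does no harm.

The technical device for circuits acting on part of a register is `slice`: with the remaining qubits
fixed, a relabelled circuit acts on each block separately (`slice_run`), and a partial trace is a
normalised sum of diagonal blocks (`reduceReg_eq_sum_slice`). -/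

theorem extend_comp_emb (f : ι ↪ κ) (u : ι → Bool) (x : κ → Bool) :
    Function.extend f u x ∘ f = u :=
  Function.extend_comp f.injective u x

theorem extend_apply_emb (f : ι ↪ κ) (u : ι → Bool) (x : κ → Bool) (i : ι) :
    Function.extend f u x (f i) = u i :=
  f.injective.extend_apply u x i

theorem extend_apply_of_notMem (f : ι ↪ κ) (u : ι → Bool) (x : κ → Bool) {j : κ}
    (hj : j ∉ Set.range f) : Function.extend f u x j = x j :=
  Function.extend_apply' u x j hj

theorem extend_comp_disjoint (f : ι ↪ κ) (g : τ ↪ κ) (h : ∀ i j, f i ≠ g j)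
    (u : ι → Bool) (x : κ → Bool) : Function.extend f u x ∘ g = x ∘ g := by
  ext j
  exact extend_apply_of_notMem f u x (by rintro ⟨i, hi⟩; exact h i j hi)

theorem eq_extend_iff (f : ι ↪ κ) (u : ι → Bool) (x y : κ → Bool) :
    y = Function.extend f u x ↔ y ∘ f = u ∧ ∀ j, j ∉ Set.range f → x j = y j := by
  constructor
  · rintro rfl
    exact ⟨extend_comp_emb f u x, fun j hj => (extend_apply_of_notMem f u x hj).symm⟩
  · rintro ⟨rfl, h⟩
    ext j
    by_cases hj : j ∈ Set.range f
    · obtain ⟨i, rfl⟩ := hj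
      rw [extend_apply_emb]; rfl
    · rw [extend_apply_of_notMem f _ x hj, h j hj]

theorem extend_comp_self (f : ι ↪ κ) (x : κ → Bool) : Function.extend f (x ∘ f) x = x :=
  ((eq_extend_iff f _ x x).2 ⟨rfl, fun _ _ => rfl⟩).symm

theorem extend_extend (f : ι ↪ κ) (u v : ι → Bool) (x : κ → Bool) :
    Function.extend f u (Function.extend f v x) = Function.extend f u x := by
  rw [eq_extend_iff]
  refine ⟨extend_comp_emb _ _ _, fun j hj => ?_⟩
  rw [extend_apply_of_notMem f _ _ hj, extend_apply_of_notMem f _ _ hj]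

theorem update_extend [DecidableEq ι] [DecidableEq κ] (f : ι ↪ κ) (u : ι → Bool) (x : κ → Bool)
    (i : ι) (b : Bool) :
    Function.update (Function.extend f u x) (f i) b =
      Function.extend f (Function.update u i b) x := by
  rw [eq_extend_iff]
  constructor
  · ext j
    by_cases h : j = i
    · subst h; simp
    · have : f j ≠ f i := f.injective.ne h
      simp [h, extend_apply_emb]
  · intro j hj
    have : j ≠ f i := by rintro rfl; exact hj ⟨i, rfl⟩
    rw [Function.update_of_ne this, extend_apply_of_notMem f _ _ hj]

/-- The block of `X` obtained by fixing all qubits outside of the range of `f`: to `x` in the rows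
and to `y` in the columns. -/
def slice (f : ι ↪ κ) (x y : κ → Bool) : QOp κ →ₗ[ℂ] QOp ι where
  toFun X := Matrix.of fun u v => X (Function.extend f u x) (Function.extend f v y)
  map_add' _ _ := rfl
  map_smul' _ _ := rfl

theorem slice_apply (f : ι ↪ κ) (x y : κ → Bool) (X : QOp κ) (u v : ι → Bool) :
    slice f x y X u v = X (Function.extend f u x) (Function.extend f v y) := rfl

theorem apply_eq_slice (f : ι ↪ κ) (x y : κ → Bool) (X : QOp κ) :
    X x y = slice f x y X (x ∘ f) (y ∘ f) := by
  rw [slice_apply, extend_comp_self, extend_comp_self]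

/-- Swapping the values on the range of `f` with `u` is an involution of the pairs `(z, u)`, so each
string is reached $2^{|\iota|}$ times. This replaces sums over the qubits outside the range by sums
over whole strings, without a type for the complement. -/
theorem sum_sum_extend [Fintype ι] [Fintype κ] [DecidableEq ι] [DecidableEq κ] (f : ι ↪ κ)
    (G : (κ → Bool) → ℂ) :
    ∑ z, ∑ u, G (Function.extend f u z) = (2 : ℂ) ^ Fintype.card ι * ∑ x, G x := by
  let σ : (κ → Bool) × (ι → Bool) → (κ → Bool) × (ι → Bool) :=
    fun p => (Function.extend f p.2 p.1, p.1 ∘ f)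
  have hσ : Function.Involutive σ := by
    rintro ⟨z, u⟩
    simp only [σ, extend_extend, extend_comp_self, extend_comp_emb]
  calc ∑ z, ∑ u, G (Function.extend f u z)
      = ∑ p : (κ → Bool) × (ι → Bool), G (σ p).1 := by rw [Fintype.sum_prod_type]
    _ = ∑ p : (κ → Bool) × (ι → Bool), G p.1 :=
        Equiv.sum_comp hσ.toPerm (fun p : (κ → Bool) × (ι → Bool) => G p.1)
    _ = _ := by
        rw [Fintype.sum_prod_type, Finset.mul_sum]
        simp

/-- The sum over full strings `z` counts every assignment of the discarded qubits $2^{|\iota|}$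
times, whence the normalising factor. -/
theorem reduceReg_apply [Fintype ι] [Fintype κ] [DecidableEq ι] [DecidableEq κ] (f : ι ↪ κ)
    (X : QOp κ) (u v : ι → Bool) :
    reduceReg f X u v = ((2 : ℂ) ^ Fintype.card ι)⁻¹ *
      ∑ z, X (Function.extend f u z) (Function.extend f v z) := by
  classical
  have h2 : (2 : ℂ) ^ Fintype.card ι ≠ 0 := pow_ne_zero _ two_ne_zero
  rw [eq_inv_mul_iff_mul_eq₀ h2]
  have h1 : reduceReg f X u v =
      ∑ x, if x ∘ f = u then X x (Function.extend f v x) else 0 := by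
    simp only [reduceReg, LinearMap.coe_mk, AddHom.coe_mk, Matrix.of_apply]
    refine Finset.sum_congr rfl fun x _ => ?_
    rw [Finset.sum_eq_single (Function.extend f v x)]
    · have := (eq_extend_iff f v x _).1 rfl
      split_ifs with h3 h4 h4
      · rfl
      · exact absurd h3.1 h4
      · exact absurd ⟨h4, this⟩ h3
      · rfl
    · intro y _ hy
      rw [if_neg]
      rintro ⟨-, h⟩
      exact hy ((eq_extend_iff f v x y).2 h)
    · simp
  rw [h1, ← sum_sum_extend f]
  refine Finset.sum_congr rfl fun z _ => ?_
  simp only [extend_comp_emb, extend_extend]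
  simp

theorem reduceReg_eq_sum_slice [Fintype ι] [Fintype κ] [DecidableEq ι] [DecidableEq κ] (f : ι ↪ κ)
    (X : QOp κ) :
    reduceReg f X = ((2 : ℂ) ^ Fintype.card ι)⁻¹ • ∑ z, slice f z z X := by
  ext u v
  rw [reduceReg_apply, Matrix.smul_apply, Matrix.sum_apply, smul_eq_mul]
  rfl

theorem trace_reduceReg [Fintype ι] [Fintype κ] [DecidableEq ι] [DecidableEq κ] (f : ι ↪ κ)
    (X : QOp κ) : (reduceReg f X).trace = X.trace := by
  have h2 : (2 : ℂ) ^ Fintype.card ι ≠ 0 := pow_ne_zero _ two_ne_zero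
  simp only [Matrix.trace, Matrix.diag, reduceReg_apply]
  rw [← Finset.mul_sum, inv_mul_eq_iff_eq_mul₀ h2, Finset.sum_comm]
  exact sum_sum_extend f fun x => X x x

theorem initReg_apply (f : ι ↪ κ) (X : QOp ι) (x y : κ → Bool) [Decidable
    ((∀ j, j ∉ Set.range f → x j = false) ∧ (∀ j, j ∉ Set.range f → y j = false))] :
    initReg f X x y =
      if (∀ j, j ∉ Set.range f → x j = false) ∧ (∀ j, j ∉ Set.range f → y j = false)
      then X (x ∘ f) (y ∘ f) else 0 := by
  simp only [initReg, LinearMap.coe_mk, AddHom.coe_mk, Matrix.of_apply]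
  congr

/-- The amplitude `1` if all qubits outside of the range of `f` are `0`, and `0` otherwise. -/
def offZero (f : ι ↪ κ) (x : κ → Bool) : ℂ :=
  open Classical in if ∀ j, j ∉ Set.range f → x j = false then 1 else 0

/-- The factored form exhibits the map as a conjugation, which gives positivity and sends product
vectors to product vectors. -/
theorem initReg_apply_mul (f : ι ↪ κ) (X : QOp ι) (x y : κ → Bool) :
    initReg f X x y = offZero f x * star (offZero f y) * X (x ∘ f) (y ∘ f) := by
  classical
  rw [initReg_apply, offZero, offZero]
  split_ifs <;> first | (exfalso; tauto) | simp

theorem offZero_extend (f : ι ↪ κ) (u : ι → Bool) (x : κ → Bool) :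
    offZero f (Function.extend f u x) = offZero f x := by
  classical
  have : (∀ j, j ∉ Set.range f → Function.extend f u x j = false) ↔
      ∀ j, j ∉ Set.range f → x j = false :=
    forall₂_congr fun j hj => by rw [extend_apply_of_notMem f u x hj]
  simp only [offZero, this]

theorem slice_initReg (f : ι ↪ κ) (x y : κ → Bool) (X : QOp ι) :
    slice f x y (initReg f X) = (offZero f x * star (offZero f y)) • X := by
  ext u v
  rw [slice_apply, initReg_apply_mul, offZero_extend, offZero_extend, extend_comp_emb,
    extend_comp_emb, Matrix.smul_apply, smul_eq_mul]

theorem offZero_trans (f : ι ↪ κ) (g : κ ↪ τ) (x : τ → Bool) :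
    offZero (f.trans g) x = offZero g x * offZero f (x ∘ g) := by
  classical
  have : (∀ j, j ∉ Set.range (f.trans g) → x j = false) ↔
      (∀ j, j ∉ Set.range g → x j = false) ∧ (∀ j, j ∉ Set.range f → (x ∘ g) j = false) := by
    constructor
    · refine fun h => ⟨fun j hj => h j ?_, fun j hj => h (g j) ?_⟩
      · rintro ⟨i, rfl⟩; exact hj ⟨f i, rfl⟩
      · rintro ⟨i, hi⟩; exact hj ⟨i, g.injective hi⟩
    · rintro ⟨h1, h2⟩ j hj
      by_cases h : j ∈ Set.range g
      · obtain ⟨k, rfl⟩ := h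
        exact h2 k (by rintro ⟨i, rfl⟩; exact hj ⟨i, rfl⟩)
      · exact h1 j h
  simp only [offZero, this]
  split_ifs <;> first | (exfalso; tauto) | simp

theorem initReg_trans (f : ι ↪ κ) (g : κ ↪ τ) (X : QOp ι) :
    initReg (f.trans g) X = initReg g (initReg f X) := by
  ext x y
  rw [initReg_apply_mul, initReg_apply_mul, initReg_apply_mul, offZero_trans, offZero_trans]
  simp only [star_mul']
  rw [show x ∘ (f.trans g) = (x ∘ g) ∘ f from rfl, show y ∘ (f.trans g) = (y ∘ g) ∘ f from rfl]
  ring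

theorem initReg_zeroState (f : ι ↪ κ) : initReg f (zeroState ι) = zeroState κ := by
  classical
  ext x y
  have h : ∀ x : κ → Bool, (∀ j, x j = false) ↔
      (∀ j, j ∉ Set.range f → x j = false) ∧ ∀ i, (x ∘ f) i = false := by
    intro x
    refine ⟨fun h => ⟨fun j _ => h j, fun i => h (f i)⟩, fun ⟨h1, h2⟩ j => ?_⟩
    by_cases hj : j ∈ Set.range f
    · obtain ⟨i, rfl⟩ := hj; exact h2 i
    · exact h1 j hj
  rw [initReg_apply]
  simp only [zeroState, Matrix.of_apply, h x, h y]
  split_ifs <;> first | (exfalso; tauto) | simp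

theorem reduceReg_initReg [Fintype ι] [Fintype κ] [DecidableEq ι] [DecidableEq κ] (f : ι ↪ κ)
    (X : QOp ι) : reduceReg f (initReg f X) = X := by
  rw [reduceReg_eq_sum_slice]
  simp only [slice_initReg]
  rw [← Finset.sum_smul, smul_smul]
  have h2 : (2 : ℂ) ^ Fintype.card ι ≠ 0 := pow_ne_zero _ two_ne_zero
  have : ∑ z : κ → Bool, offZero f z * star (offZero f z) = (2 : ℂ) ^ Fintype.card ι := by
    -- Counting the all-zero string by `sum_sum_extend` gives the number of strings that vanish
    -- outside the range of `f`.
    have h := sum_sum_extend f fun z => if z = fun _ => false then (1 : ℂ) else 0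
    rw [Finset.sum_ite_eq' Finset.univ (fun _ => false) (fun _ => (1 : ℂ)),
      if_pos (Finset.mem_univ _), mul_one] at h
    rw [← h]
    refine Finset.sum_congr rfl fun z _ => ?_
    classical
    have h3 : ∀ u, (Function.extend f u z = fun _ => false) ↔
        (u = fun _ => false) ∧ ∀ j, j ∉ Set.range f → z j = false := by
      intro u
      rw [eq_comm, eq_extend_iff]
      refine and_congr ?_ Iff.rfl
      rw [eq_comm]; rfl
    simp only [h3, offZero, ite_and]
    rw [Finset.sum_ite_eq' Finset.univ]
    simp only [Finset.mem_univ, if_true]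
    split_ifs <;> simp
  rw [this, inv_mul_cancel₀ h2, one_smul]

theorem trace_initReg [Fintype ι] [Fintype κ] [DecidableEq ι] [DecidableEq κ] (f : ι ↪ κ)
    (X : QOp ι) : (initReg f X).trace = X.trace := by
  rw [← trace_reduceReg f, reduceReg_initReg]

theorem reduceReg_trans [Fintype ι] [Fintype κ] [Fintype τ] [DecidableEq ι] [DecidableEq κ]
    [DecidableEq τ] (f : ι ↪ κ) (g : κ ↪ τ) (X : QOp τ) :
    reduceReg (f.trans g) X = reduceReg f (reduceReg g X) := by
  ext u v
  have h2 : (2 : ℂ) ^ Fintype.card κ ≠ 0 := pow_ne_zero _ two_ne_zero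
  simp only [reduceReg_apply]
  congr 1
  rw [← Finset.mul_sum, eq_inv_mul_iff_mul_eq₀ h2, Finset.sum_comm, ← sum_sum_extend g]
  refine Finset.sum_congr rfl fun z _ => Finset.sum_congr rfl fun w _ => ?_
  have h : ∀ u : ι → Bool, Function.extend (f.trans g) u (Function.extend g w z) =
      Function.extend g (Function.extend f u w) z := by
    intro u
    rw [eq_comm, eq_extend_iff]
    constructor
    · rw [show ∀ x : τ → Bool, x ∘ (f.trans g) = (x ∘ g) ∘ f from fun _ => rfl, extend_comp_emb,
        extend_comp_emb]
    · intro j hj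
      by_cases h : j ∈ Set.range g
      · obtain ⟨k, rfl⟩ := h
        rw [extend_apply_emb, extend_apply_emb, extend_apply_of_notMem]
        rintro ⟨i, rfl⟩; exact hj ⟨i, rfl⟩
      · rw [extend_apply_of_notMem g _ _ h, extend_apply_of_notMem g _ _ h]
  rw [h u, h v]

end Slices

/-! ### The action of gates and circuits -/

section Gates

variable {ι κ : Type} [DecidableEq ι] [Fintype ι] [DecidableEq κ] [Fintype κ]

theorem conjBy_apply {a : Type} [Fintype a] (U X : Op a) (x y : a) :
    conjBy U X x y = ∑ p, U x p * ∑ q, star (U y q) * X p q := by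
  simp only [conjBy, LinearMap.coe_mk, AddHom.coe_mk, Matrix.mul_apply,
    Matrix.conjTranspose_apply, Finset.sum_mul, Finset.mul_sum]
  rw [Finset.sum_comm]
  refine Finset.sum_congr rfl fun p _ => Finset.sum_congr rfl fun q _ => by ring

theorem conjBy_basisMap_apply {g : (ι → Bool) → (ι → Bool)} (hg : Function.Involutive g)
    (X : QOp ι) (x y : ι → Bool) : conjBy (basisMap g) X x y = X (g x) (g y) := by
  have h : ∀ x p, basisMap g x p = if p = g x then (1 : ℂ) else 0 := by
    intro x p
    simp only [basisMap, Matrix.of_apply]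
    congr 1
    exact propext ⟨fun h => by rw [h, hg], fun h => by rw [h, hg]⟩
  rw [conjBy_apply]
  simp [h]

/-- The basis map of a classical gate; the identity for all other gates. -/
def Gate.perm : Gate ι → (ι → Bool) → (ι → Bool)
  | .x i => fun x => Function.update x i (!x i)
  | .cnot i j _ => fun x => Function.update x j (xor (x j) (x i))
  | .toffoli i j k _ _ _ => fun x => Function.update x k (xor (x k) (x i && x j))
  | _ => id

/-- The gates that permute the computational basis. -/
def Gate.IsClassical : Gate ι → Prop
  | .x _ | .cnot _ _ _ | .toffoli _ _ _ _ _ _ => True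
  | _ => False

theorem Gate.perm_involutive (g : Gate ι) : Function.Involutive g.perm := by
  intro x
  cases g with
  | x i => simp [Gate.perm]
  | cnot i j h => simp [Gate.perm, Function.update_of_ne h]
  | toffoli i j k hij hik hjk =>
    simp [Gate.perm, Function.update_of_ne hik, Function.update_of_ne hjk]
  | h i => rfl
  | t i => rfl
  | meas i => rfl

theorem Gate.run_classical_apply {g : Gate ι} (hg : g.IsClassical) (X : QOp ι)
    (x y : ι → Bool) : g.run X x y = X (g.perm x) (g.perm y) := by
  have h := g.perm_involutive
  cases g with
  | x i => exact conjBy_basisMap_apply h X x y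
  | cnot i j hij => exact conjBy_basisMap_apply h X x y
  | toffoli i j k hij hik hjk => exact conjBy_basisMap_apply h X x y
  | h i => exact hg.elim
  | t i => exact hg.elim
  | meas i => exact hg.elim

theorem Gate.perm_map_extend (g : Gate ι) (f : ι ↪ κ) (u : ι → Bool) (x : κ → Bool) :
    (g.map f).perm (Function.extend f u x) = Function.extend f (g.perm u) x := by
  cases g <;> simp [Gate.perm, Gate.map, update_extend, extend_apply_emb]

/-- The sign `(-1)^b`. -/
def sgn (b : Bool) : ℂ := if b then -1 else 1

theorem sum_hadamard (i : ι) (x : ι → Bool) (G : (ι → Bool) → ℂ) :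
    ∑ p, hadamard i x p * G p =
      ((1 / √2 : ℝ) : ℂ) * ∑ b, sgn (x i && b) * G (Function.update x i b) := by
  rw [Finset.mul_sum]
  symm
  apply Fintype.sum_of_injective (fun b => Function.update x i b)
    (Function.update_injective x i)
  · intro p hp
    have : ¬ ∀ j, j ≠ i → x j = p j := by
      intro h
      refine hp ⟨p i, ?_⟩
      ext j
      by_cases hj : j = i
      · subst hj; simp
      · simp [hj, h j hj]
    simp [hadamard, this]
  · intro b
    have : ∀ j, j ≠ i → x j = Function.update x i b j := fun j hj => by simp [hj]
    rw [hadamard, Matrix.of_apply, if_pos this, Function.update_self, sgn, mul_assoc]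

theorem inv_sqrt_two_mul_self : ((1 / √2 : ℝ) : ℂ) * ((1 / √2 : ℝ) : ℂ) = 1 / 2 := by
  rw [← Complex.ofReal_mul, div_mul_div_comm, Real.mul_self_sqrt (by norm_num)]
  norm_num

theorem star_hadamard (i : ι) (x y : ι → Bool) : star (hadamard i x y) = hadamard i x y := by
  simp only [hadamard, Matrix.of_apply]
  split_ifs <;> simp

theorem hadamard_comm (i : ι) (x y : ι → Bool) : hadamard i x y = hadamard i y x := by
  simp only [hadamard, Matrix.of_apply, Bool.and_comm (x i)]
  congr 1
  exact propext (forall₂_congr fun j _ => eq_comm)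

theorem run_h_apply (i : ι) (X : QOp ι) (x y : ι → Bool) :
    (Gate.h i).run X x y = 1 / 2 * ∑ b, sgn (x i && b) * ∑ c, sgn (y i && c) *
      X (Function.update x i b) (Function.update y i c) := by
  rw [Gate.run, conjBy_apply]
  simp only [star_hadamard, sum_hadamard]
  rw [← inv_sqrt_two_mul_self, mul_assoc]
  congr 1
  rw [Finset.mul_sum]
  exact Finset.sum_congr rfl fun b _ => by ring

/-- The phase of the `T` gate. -/
def tPhase (b : Bool) : ℂ := if b then Complex.exp (Real.pi / 4 * Complex.I) else 1

theorem run_t_apply (i : ι) (X : QOp ι) (x y : ι → Bool) :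
    (Gate.t i).run X x y = tPhase (x i) * (star (tPhase (y i)) * X x y) := by
  have h : ∀ x p : ι → Bool, tGate i x p = if x = p then tPhase (x i) else 0 := by
    intro x p
    rw [tGate, Matrix.diagonal_apply, tPhase]
  rw [Gate.run, conjBy_apply]
  simp [h, apply_ite star]

theorem run_meas_apply (i : ι) (X : QOp ι) (x y : ι → Bool) :
    (Gate.meas i).run X x y = if x i = y i then X x y else 0 := rfl

/-- A gate on the range of `f` reads and changes only those qubits, so each entry of its result
involves entries of a single block. -/
theorem slice_gate_run (f : ι ↪ κ) (g : Gate ι) (x y : κ → Bool) (X : QOp κ) :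
    slice f x y ((g.map f).run X) = g.run (slice f x y X) := by
  ext u v
  by_cases hg : g.IsClassical
  · have hg' : (g.map f).IsClassical := by cases g <;> exact hg
    rw [slice_apply, Gate.run_classical_apply hg', Gate.run_classical_apply hg, slice_apply,
      Gate.perm_map_extend, Gate.perm_map_extend]
  · cases g with
    | h i =>
      simp only [Gate.map, slice_apply, run_h_apply, update_extend, extend_apply_emb]
    | t i => simp only [Gate.map, slice_apply, run_t_apply, extend_apply_emb]
    | meas i => simp only [Gate.map, slice_apply, run_meas_apply, extend_apply_emb]
    | x i => exact (hg trivial).elim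
    | cnot i j h => exact (hg trivial).elim
    | toffoli i j k h1 h2 h3 => exact (hg trivial).elim

/-- Operations on the range of `f` act on every slice. -/
theorem slice_run (f : ι ↪ κ) (c : Circuit ι) (x y : κ → Bool) (X : QOp κ) :
    slice f x y (Circuit.run (c.map (Gate.map f)) X) = Circuit.run c (slice f x y X) := by
  induction c generalizing X with
  | nil => rfl
  | cons g c ih =>
    change slice f x y (Circuit.run (c.map (Gate.map f)) ((g.map f).run X)) = _
    rw [ih, slice_gate_run]; rfl

theorem run_append (c d : Circuit ι) (X : QOp ι) :
    Circuit.run (c ++ d) X = Circuit.run d (Circuit.run c X) := by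
  induction c generalizing X with
  | nil => rfl
  | cons g c ih => exact ih (g.run X)

theorem ext_slice (f : ι ↪ κ) {X Y : QOp κ} (h : ∀ x y, slice f x y X = slice f x y Y) :
    X = Y := by
  ext x y
  rw [apply_eq_slice f x y X, apply_eq_slice f x y Y, h]

theorem run_map_initReg (f : ι ↪ κ) (c : Circuit ι) (X : QOp ι) :
    Circuit.run (c.map (Gate.map f)) (initReg f X) = initReg f (Circuit.run c X) := by
  apply ext_slice f
  intro x y
  rw [slice_run, slice_initReg, slice_initReg, map_smul]

theorem reduceReg_run_map (f : ι ↪ κ) (c : Circuit ι) (X : QOp κ) :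
    reduceReg f (Circuit.run (c.map (Gate.map f)) X) = Circuit.run c (reduceReg f X) := by
  simp only [reduceReg_eq_sum_slice, slice_run, map_smul, map_sum]

/-! #### Positivity, trace and adjointness -/

theorem posSemidef_conjBy {X : QOp ι} (U : QOp ι) (hX : X.PosSemidef) :
    (conjBy U X).PosSemidef :=
  hX.mul_mul_conjTranspose_same U

theorem posSemidef_gate_run (g : Gate ι) {X : QOp ι} (hX : X.PosSemidef) :
    (g.run X).PosSemidef := by
  cases g with
  | meas i =>
    -- A measurement is the sum of the conjugations by its two outcome projectors.
    have : (Gate.meas i).run X =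
        conjBy (Matrix.diagonal fun x => if x i then 1 else 0) X +
        conjBy (Matrix.diagonal fun x => if x i then 0 else 1) X := by
      ext x y
      simp only [run_meas_apply, Matrix.add_apply, conjBy_apply, Matrix.diagonal_apply]
      cases hx : x i <;> cases hy : y i <;> simp [apply_ite star]
    rw [this]
    exact (posSemidef_conjBy _ hX).add (posSemidef_conjBy _ hX)
  | _ => exact posSemidef_conjBy _ hX

theorem posSemidef_run (c : Circuit ι) {X : QOp ι} (hX : X.PosSemidef) :
    (Circuit.run c X).PosSemidef := by
  induction c generalizing X with
  | nil => exact hX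
  | cons g c ih => exact ih (posSemidef_gate_run g hX)

/-- All gates but `T`. -/
def Gate.NoT : Gate ι → Prop
  | .t _ => False
  | _ => True

theorem trace_conjBy_mul {a : Type} [Fintype a] {U : Op a} (hU : Uᴴ = U) (X Y : Op a) :
    (conjBy U X * Y).trace = (X * conjBy U Y).trace := by
  change (U * X * Uᴴ * Y).trace = (X * (U * Y * Uᴴ)).trace
  rw [hU, mul_assoc, mul_assoc, Matrix.trace_mul_comm]
  simp only [mul_assoc]

theorem basisMap_isHermitian {g : (ι → Bool) → (ι → Bool)} (hg : Function.Involutive g) :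
    (basisMap g)ᴴ = basisMap g := by
  ext x y
  simp only [basisMap, Matrix.conjTranspose_apply, Matrix.of_apply, apply_ite star, star_one,
    star_zero]
  congr 1
  exact propext ⟨fun h => by rw [h, hg], fun h => by rw [h, hg]⟩

/-- The unitaries `X`, `H`, `CNOT` and Toffoli are Hermitian and a measurement is a symmetric mask
on entries, so each is self-adjoint for the trace pairing. The `T` gate is not Hermitian and is
excluded. -/
theorem trace_gate_run_mul {g : Gate ι} (hg : g.NoT) (X Y : QOp ι) :
    (g.run X * Y).trace = (X * g.run Y).trace := by
  have hp := g.perm_involutive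
  cases g with
  | x i => exact trace_conjBy_mul (basisMap_isHermitian hp) X Y
  | cnot i j hij => exact trace_conjBy_mul (basisMap_isHermitian hp) X Y
  | toffoli i j k hij hik hjk => exact trace_conjBy_mul (basisMap_isHermitian hp) X Y
  | h i =>
    refine trace_conjBy_mul ?_ X Y
    ext x y
    rw [Matrix.conjTranspose_apply, star_hadamard, hadamard_comm]
  | t i => exact hg.elim
  | meas i =>
    simp only [Matrix.trace, Matrix.diag, Matrix.mul_apply, run_meas_apply]
    refine Finset.sum_congr rfl fun x _ => Finset.sum_congr rfl fun y _ => ?_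
    by_cases h : x i = y i <;> simp [h, eq_comm]

/-- The reversed list is the adjoint of the circuit. Applied to the EPR preparation, it turns the
overlap with $\Phi^{\otimes m}$ into an overlap with $|0\dots0\rangle$. -/
theorem trace_run_mul {c : Circuit ι} (hc : ∀ g ∈ c, g.NoT) (X Y : QOp ι) :
    (Circuit.run c.reverse X * Y).trace = (X * Circuit.run c Y).trace := by
  induction c generalizing Y with
  | nil => rfl
  | cons g c ih =>
    rw [List.reverse_cons, run_append]
    change (g.run (Circuit.run c.reverse X) * Y).trace = (X * Circuit.run c (g.run Y)).trace
    rw [trace_gate_run_mul (hc g (by simp)), ih fun g' hg' => hc g' (by simp [hg'])]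

theorem trace_run_classical {g : Gate ι} (hg : g.IsClassical) (X : QOp ι) :
    (g.run X).trace = X.trace :=
  (Finset.sum_congr rfl fun x _ => Gate.run_classical_apply hg X x x).trans
    (Equiv.sum_comp (Gate.perm_involutive g).toPerm fun x => X x x)

theorem trace_gate_run (g : Gate ι) (X : QOp ι) : (g.run X).trace = X.trace := by
  cases g with
  | meas i => simp [Matrix.trace, Matrix.diag, run_meas_apply]
  | t i =>
    have h : ∀ b, tPhase b * star (tPhase b) = 1 := by
      intro b
      cases b
      · simp [tPhase]
      · simp only [tPhase, if_true, Complex.star_def, ← Complex.exp_conj, ← Complex.exp_add]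
        have : (starRingEnd ℂ) 4 = 4 := Complex.conj_ofNat 4
        simp [this]
    simp only [Matrix.trace, Matrix.diag, run_t_apply, ← mul_assoc, h, one_mul]
  | h i =>
    have h := trace_gate_run_mul (g := Gate.h i) trivial X 1
    rw [mul_one] at h
    rw [h]
    -- By self-adjointness, trace preservation reduces to the fact that the Hadamard conjugation
    -- fixes the identity.
    have h1 : (Gate.h i).run (1 : QOp ι) = 1 := by
      ext x y
      rw [run_h_apply]
      by_cases hxy : ∀ j, j ≠ i → x j = y j
      · have hu : ∀ b c, (Function.update x i b = Function.update y i c) ↔ b = c := by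
          intro b c
          constructor
          · intro h; simpa using congrFun h i
          · rintro rfl
            ext j
            by_cases hj : j = i
            · subst hj; simp
            · simp [hj, hxy j hj]
        have hxy' : x = y ↔ x i = y i := by
          refine ⟨fun h => by rw [h], fun h => ?_⟩
          ext j
          by_cases hj : j = i
          · subst hj; exact h
          · exact hxy j hj
        simp only [Matrix.one_apply, hu, hxy']
        cases x i <;> cases y i <;> (simp [sgn]; try norm_num)
      · have hne : ∀ b c, Function.update x i b ≠ Function.update y i c := by
          intro b c h
          exact hxy fun j hj => by simpa [hj] using congrFun h j
        have hne' : x ≠ y := by rintro rfl; exact hxy fun _ _ => rfl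
        simp [hne, hne']
    rw [h1, mul_one]
  | x i => exact trace_run_classical (g := .x i) trivial X
  | cnot i j h => exact trace_run_classical (g := .cnot i j h) trivial X
  | toffoli i j k h1 h2 h3 => exact trace_run_classical (g := .toffoli i j k h1 h2 h3) trivial X

theorem trace_run (c : Circuit ι) (X : QOp ι) : (Circuit.run c X).trace = X.trace := by
  induction c generalizing X with
  | nil => rfl
  | cons g c ih => exact (ih (g.run X)).trans (trace_gate_run g X)

theorem posSemidef_slice (f : ι ↪ κ) (x : κ → Bool) {X : QOp κ} (hX : X.PosSemidef) :
    (slice f x x X).PosSemidef :=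
  hX.submatrix fun u => Function.extend f u x

theorem posSemidef_reduceReg (f : ι ↪ κ) {X : QOp κ} (hX : X.PosSemidef) :
    (reduceReg f X).PosSemidef := by
  rw [reduceReg_eq_sum_slice]
  refine (Matrix.posSemidef_sum _ fun z _ => posSemidef_slice f z hX).smul ?_
  rw [← Nat.cast_ofNat, ← Nat.cast_pow, ← Complex.ofReal_natCast, ← Complex.ofReal_inv,
    Complex.zero_le_real]
  positivity

theorem posSemidef_initReg (f : ι ↪ κ) {X : QOp ι} (hX : X.PosSemidef) :
    (initReg f X).PosSemidef := by
  have : initReg f X = Matrix.diagonal (offZero f) * X.submatrix (· ∘ f) (· ∘ f) *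
      (Matrix.diagonal (offZero f))ᴴ := by
    ext x y
    rw [initReg_apply_mul, Matrix.diagonal_conjTranspose, Matrix.mul_diagonal,
      Matrix.diagonal_mul, Matrix.submatrix_apply, Pi.star_apply]
    ring
  rw [this]
  exact (hX.submatrix _).mul_mul_conjTranspose_same _

theorem isDensity_channelCircuit_run (c : ChannelCircuit ι κ) {X : QOp ι} (hX : IsDensity X) :
    IsDensity (c.run X) := by
  refine ⟨posSemidef_reduceReg _ (posSemidef_run _ (posSemidef_initReg _ hX.1)), ?_⟩
  change (reduceReg _ (Circuit.run _ (initReg _ X))).trace = 1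
  rw [trace_reduceReg, trace_run, trace_initReg, hX.2]

/-- Seen from the empty register, all qubits are ancillas; positivity and trace of the zero state
then follow from those of `initReg`. -/
theorem zeroState_apply {σ : Type} (x y : σ → Bool) :
    zeroState σ x y = offZero (ι := Empty) ⟨Empty.elim, fun a => a.elim⟩ x *
      star (offZero (ι := Empty) ⟨Empty.elim, fun a => a.elim⟩ y) := by
  classical
  simp only [zeroState, offZero, Matrix.of_apply, Set.range_eq_empty,
    Set.mem_empty_iff_false, not_false_eq_true, forall_const]
  split_ifs <;> first | (exfalso; tauto) | simp

theorem isDensity_zeroState : IsDensity (zeroState ι) := by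
  let f : Empty ↪ ι := ⟨Empty.elim, fun a => a.elim⟩
  have h : IsDensity (1 : QOp Empty) := ⟨Matrix.PosSemidef.one, by simp⟩
  have h1 : zeroState ι = initReg f 1 := by
    ext x y
    rw [zeroState_apply, initReg_apply_mul, Subsingleton.elim (x ∘ f) (y ∘ f),
      Matrix.one_apply_eq, mul_one]
  rw [h1]
  exact ⟨posSemidef_initReg f h.1, by rw [trace_initReg, h.2]⟩

end Gates

/-! ### Singular values, traces and ranks -/

section SingularValues

variable {a : Type} [Fintype a] [DecidableEq a]

/-- The image under `M` of a right singular vector has the norm of the singular value. -/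
theorem norm_toEuclideanLin_eigenvectorBasis (M : Op a) (i : a) :
    ‖M.toEuclideanLin ((Matrix.isHermitian_conjTranspose_mul_self M).eigenvectorBasis i)‖ =
      √((Matrix.isHermitian_conjTranspose_mul_self M).eigenvalues i) := by
  set hM := Matrix.isHermitian_conjTranspose_mul_self M
  set v := hM.eigenvectorBasis i with hv
  have h1 : ‖M.toEuclideanLin v‖ ^ 2 = hM.eigenvalues i := by
    have h2 : inner ℂ (M.toEuclideanLin v) (M.toEuclideanLin v) =
        inner ℂ v ((Mᴴ * M).toEuclideanLin v) := by
      rw [← LinearMap.adjoint_inner_right, ← Matrix.toEuclideanLin_conjTranspose_eq_adjoint]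
      simp only [Matrix.toLpLin_apply, Matrix.mulVec_mulVec]
    have h3 : (Mᴴ * M).toEuclideanLin v = (hM.eigenvalues i : ℂ) • v := by
      rw [Matrix.toLpLin_apply, hv, hM.mulVec_eigenvectorBasis i]
      ext j
      simp
    have h4 : inner ℂ v v = (1 : ℂ) := by
      rw [inner_self_eq_norm_sq_to_K, hv, hM.eigenvectorBasis.norm_eq_one]
      simp
    rw [h3, inner_smul_right, h4, mul_one, inner_self_eq_norm_sq_to_K] at h2
    exact Complex.ofReal_injective (by simpa using h2)
  rw [← h1, Real.sqrt_sq (norm_nonneg _)]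

/-- Expand `v` in the right singular basis: the coefficients have modulus at most 1 and the image of
each basis vector has the norm of its singular value. -/
theorem norm_inner_le_traceNorm (M : Op a) (v : EuclideanSpace ℂ a) (hv : ‖v‖ ≤ 1) :
    ‖inner ℂ v (M.toEuclideanLin v)‖ ≤ traceNorm M := by
  set hM := Matrix.isHermitian_conjTranspose_mul_self M
  calc ‖inner ℂ v (M.toEuclideanLin v)‖ ≤ ‖v‖ * ‖M.toEuclideanLin v‖ := norm_inner_le_norm _ _
    _ ≤ 1 * ‖M.toEuclideanLin v‖ := by gcongr
    _ = ‖M.toEuclideanLin (∑ i, hM.eigenvectorBasis.repr v i • hM.eigenvectorBasis i)‖ := by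
      rw [one_mul, hM.eigenvectorBasis.sum_repr]
    _ ≤ ∑ i, √(hM.eigenvalues i) := by
      rw [map_sum]
      refine (norm_sum_le _ _).trans (Finset.sum_le_sum fun i _ => ?_)
      rw [map_smul, norm_smul, norm_toEuclideanLin_eigenvectorBasis]
      refine mul_le_of_le_one_left (Real.sqrt_nonneg _) ?_
      rw [hM.eigenvectorBasis.repr_apply_apply]
      refine (norm_inner_le_norm _ _).trans ?_
      rw [hM.eigenvectorBasis.norm_eq_one, one_mul]
      exact hv
    _ = traceNorm M := rfl

/-- Computed in the right singular basis, each diagonal term is bounded by the corresponding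
singular value. -/
theorem norm_trace_le_traceNorm (M : Op a) : ‖M.trace‖ ≤ traceNorm M := by
  set hM := Matrix.isHermitian_conjTranspose_mul_self M
  have h1 : M.trace = ∑ i, inner ℂ (hM.eigenvectorBasis i)
      (M.toEuclideanLin (hM.eigenvectorBasis i)) := by
    rw [← LinearMap.trace_eq_sum_inner,
      LinearMap.trace_eq_matrix_trace ℂ (PiLp.basisFun 2 ℂ a)]
    congr 1
    rw [← LinearEquiv.symm_apply_eq]
    exact (LinearMap.congr_fun (congrArg LinearEquiv.toLinearMap
      (Matrix.toLpLin_eq_toLin (R := ℂ) 2 2 (m := a) (n := a))) M).symm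
  rw [h1]
  refine (norm_sum_le _ _).trans (Finset.sum_le_sum fun i _ => ?_)
  refine (norm_inner_le_norm _ _).trans ?_
  rw [hM.eigenvectorBasis.norm_eq_one, one_mul, norm_toEuclideanLin_eigenvectorBasis]

/-- Cauchy–Schwarz over the nonzero singular values, whose number is the rank and whose squares sum
to $\mathrm{tr}\,M^\dagger M$. This is the quantitative core of the Schmidt-rank bound. -/
theorem norm_trace_sq_le_rank_mul (M : Op a) :
    ‖M.trace‖ ^ 2 ≤ M.rank * (Mᴴ * M).trace.re := by
  set hM := Matrix.isHermitian_conjTranspose_mul_self M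
  set s : Finset a := Finset.univ.filter fun i => hM.eigenvalues i ≠ 0
  have hs : (M.rank : ℝ) = s.card := by
    rw [← Matrix.rank_conjTranspose_mul_self, hM.rank_eq_card_non_zero_eigs,
      Fintype.card_subtype]
  have ht : (Mᴴ * M).trace.re = ∑ i ∈ s, hM.eigenvalues i := by
    rw [hM.trace_eq_sum_eigenvalues, Finset.sum_filter_ne_zero]
    simp
  have h1 : traceNorm M = ∑ i ∈ s, √(hM.eigenvalues i) := by
    symm
    refine Finset.sum_subset (Finset.subset_univ s) fun i _ hi => ?_
    have : hM.eigenvalues i = 0 := by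
      by_contra h
      exact hi (Finset.mem_filter.2 ⟨Finset.mem_univ _, h⟩)
    rw [this, Real.sqrt_zero]
  calc ‖M.trace‖ ^ 2 ≤ (∑ i ∈ s, √(hM.eigenvalues i)) ^ 2 := by
        rw [← h1]
        exact pow_le_pow_left₀ (norm_nonneg _) (norm_trace_le_traceNorm M) 2
    _ ≤ s.card * ∑ i ∈ s, √(hM.eigenvalues i) ^ 2 := sq_sum_le_card_mul_sum_sq
    _ = _ := by
        rw [hs, ht]
        congr 1
        refine Finset.sum_congr rfl fun i _ => Real.sq_sqrt ?_
        exact Matrix.eigenvalues_conjTranspose_mul_self_nonneg M i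

/-- Here $M^\dagger M=M$ has eigenvalues with $\lambda^2=\lambda$, so $\sqrt\lambda=\lambda$. It
makes the EPR projector admissible in the supremum of `diamondNorm`. -/
theorem traceNorm_of_isProj {M : Op a} (h1 : Mᴴ = M) (h2 : M * M = M) :
    traceNorm M = M.trace.re := by
  set hM := Matrix.isHermitian_conjTranspose_mul_self M
  have h3 : Mᴴ * M = M := by rw [h1, h2]
  have h4 : ∀ i, √(hM.eigenvalues i) = hM.eigenvalues i := by
    intro i
    have h5 : (hM.eigenvalues i) * hM.eigenvalues i = hM.eigenvalues i := by
      have e1 := hM.mulVec_eigenvectorBasis i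
      have e2 : (Mᴴ * M) *ᵥ ((Mᴴ * M) *ᵥ (hM.eigenvectorBasis i).ofLp) =
          (Mᴴ * M) *ᵥ (hM.eigenvectorBasis i).ofLp := by
        rw [Matrix.mulVec_mulVec, show Mᴴ * M * (Mᴴ * M) = Mᴴ * M by rw [h3, h2]]
      rw [e1, Matrix.mulVec_smul, e1, smul_smul] at e2
      have hne : (hM.eigenvectorBasis i).ofLp ≠ 0 := by
        intro h
        have := hM.eigenvectorBasis.norm_eq_one i
        rw [show hM.eigenvectorBasis i = 0 from WithLp.ofLp_injective 2 h] at this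
        simp at this
      exact smul_left_injective ℝ hne e2
    have h6 : (0 : ℝ) ≤ hM.eigenvalues i :=
      Matrix.eigenvalues_conjTranspose_mul_self_nonneg M i
    rw [Real.sqrt_eq_iff_mul_self_eq h6 h6, h5]
  have h7 : (Mᴴ * M).trace.re = M.trace.re := by rw [h3]
  rw [← h7, hM.trace_eq_sum_eigenvalues]
  change ∑ i, √(hM.eigenvalues i) = _
  simp [h4]

theorem exists_sum_of_posSemidef {a : Type} [Fintype a] {X : Op a} (hX : X.PosSemidef) :
    ∃ B : a → a → ℂ, ∀ x y, X x y = ∑ k, B k x * star (B k y) := by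
  classical
  open scoped MatrixOrder in
  obtain ⟨B, hB⟩ := CStarAlgebra.nonneg_iff_eq_star_mul_self.1 hX.nonneg
  refine ⟨fun k x => star (B k x), fun x y => ?_⟩
  rw [hB, Matrix.mul_apply]
  simp [Matrix.star_apply]

end SingularValues

/-! ### The Schmidt number under LOCC maps -/

section Schmidt

/-- The cone generated by the pure states of Schmidt rank at most `k`. -/
def schmidtCone (k : ℕ) (a b : Type) : AddSubmonoid (Op (a × b)) :=
  AddSubmonoid.closure {X | ∃ (U : a → Fin k → ℂ) (W : Fin k → b → ℂ), ∀ p q,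
    X p q = (∑ s, U p.1 s * W s p.2) * star (∑ s, U q.1 s * W s q.2)}

variable {a b a' b' : Type} {k : ℕ}

/-- Exchange of the two subsystems. -/
def swapOp (X : Op (a × b)) : Op (b × a) := X.submatrix Prod.swap Prod.swap

theorem mapA_eq_swapOp (E : Op a →ₗ[ℂ] Op a') (X : Op (a × b)) :
    mapA b E X = swapOp (mapB b E (swapOp X)) := rfl

theorem swapOp_mem_schmidtCone {X : Op (a × b)} (hX : X ∈ schmidtCone k a b) :
    swapOp X ∈ schmidtCone k b a := by
  induction hX using AddSubmonoid.closure_induction with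
  | mem X hX =>
    obtain ⟨U, W, h⟩ := hX
    refine AddSubmonoid.subset_closure ⟨fun j s => W s j, fun s i => U i s, fun p q => ?_⟩
    change X p.swap q.swap = _
    rw [h]
    simp only [mul_comm, Prod.fst_swap, Prod.snd_swap]
  | zero => exact zero_mem _
  | add X Y _ _ h1 h2 => exact add_mem h1 h2

/-- `IsCP` speaks of ancillas `Fin k` only; reindexing carries it to any finite ancilla. -/
theorem posSemidef_mapB [Fintype a] {E : Op b →ₗ[ℂ] Op b'} (hE : IsCP E) {X : Op (a × b)}
    (hX : X.PosSemidef) : (mapB a E X).PosSemidef := by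
  let e := Fintype.equivFin a
  have h := hE _ (X.submatrix (Prod.map e.symm id) (Prod.map e.symm id)) (hX.submatrix _)
  have h2 := h.submatrix (Prod.map e id)
  convert h2 using 1
  ext p q
  simp [mapB]

/-- A vector $\sum_s U_s\otimes W_s$ is the image under `U`, acting on the first factor, of a vector
`w` with ancilla dimension `k`. Complete positivity makes the image of $ww^\dagger$ positive
semidefinite, hence a sum of rank-one terms, and applying `U` again keeps each at Schmidt rank at
most `k`. -/
theorem mapB_mem_schmidtCone [Fintype b] [Fintype b'] {E : Op b →ₗ[ℂ] Op b'} (hE : IsCP E)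
    {X : Op (a × b)} (hX : X ∈ schmidtCone k a b) : mapB a E X ∈ schmidtCone k a b' := by
  induction hX using AddSubmonoid.closure_induction with
  | mem X hX =>
    obtain ⟨U, W, h⟩ := hX
    let w : Fin k × b → ℂ := fun p => W p.1 p.2
    obtain ⟨B, hB⟩ := exists_sum_of_posSemidef
      (hE k _ (Matrix.posSemidef_vecMulVec_self_star w))
    have h1 : ∀ p q : a × b', mapB a E X p q = ∑ s, ∑ t, U p.1 s * star (U q.1 t) *
        mapB (Fin k) E (Matrix.vecMulVec w (star w)) (s, p.2) (t, q.2) := by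
      intro p q
      have h2 : (Matrix.of fun i j => X (p.1, i) (q.1, j)) = ∑ s, ∑ t,
          (U p.1 s * star (U q.1 t)) •
            (Matrix.of fun i j => Matrix.vecMulVec w (star w) (s, i) (t, j) : Op b) := by
        ext i j
        simp only [Matrix.of_apply, h, Matrix.sum_apply, Matrix.smul_apply, smul_eq_mul,
          Matrix.vecMulVec_apply, star_sum, Finset.sum_mul_sum, Pi.star_apply, star_mul']
        exact Finset.sum_congr rfl fun s _ => Finset.sum_congr rfl fun t _ => by ring
      change E (Matrix.of fun i j => X (p.1, i) (q.1, j)) p.2 q.2 = _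
      rw [h2]
      simp only [map_sum, map_smul, Matrix.sum_apply, Matrix.smul_apply, smul_eq_mul]
      rfl
    have h3 : mapB a E X = ∑ l, Matrix.of fun p q : a × b' =>
        (∑ s, U p.1 s * B l (s, p.2)) * star (∑ s, U q.1 s * B l (s, q.2)) := by
      ext p q
      simp only [h1, hB, Matrix.sum_apply, Matrix.of_apply, star_sum, Finset.sum_mul_sum,
        star_mul']
      symm
      rw [Finset.sum_comm]
      refine Finset.sum_congr rfl fun s _ => ?_
      rw [Finset.sum_comm]
      refine Finset.sum_congr rfl fun t _ => ?_
      rw [Finset.mul_sum]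
      exact Finset.sum_congr rfl fun l _ => by ring
    rw [h3]
    exact sum_mem fun l _ => AddSubmonoid.subset_closure
      ⟨U, fun s j => B l (s, j), fun p q => rfl⟩
  | zero => rw [map_zero]; exact zero_mem _
  | add X Y _ _ h1 h2 => rw [map_add]; exact add_mem h1 h2

theorem mapA_mem_schmidtCone [Fintype a] [Fintype a'] {E : Op a →ₗ[ℂ] Op a'} (hE : IsCP E)
    {X : Op (a × b)} (hX : X ∈ schmidtCone k a b) : mapA b E X ∈ schmidtCone k a' b := by
  rw [mapA_eq_swapOp]
  exact swapOp_mem_schmidtCone (mapB_mem_schmidtCone hE (swapOp_mem_schmidtCone hX))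

theorem IsLOCC.mem_schmidtCone [Fintype a] [Fintype b] [Fintype a'] [Fintype b']
    {Γ : Op (a × b) →ₗ[ℂ] Op (a' × b')} (hΓ : IsLOCC Γ) {X : Op (a × b)}
    (hX : X ∈ schmidtCone k a b) : Γ X ∈ schmidtCone k a' b' := by
  induction hΓ with
  | done => exact hX
  | alice K E hcp htp Γ hΓ ih =>
    rw [LinearMap.sum_apply]
    exact sum_mem fun k _ => ih k (mapA_mem_schmidtCone (hcp k) hX)
  | bob K E hcp htp Γ hΓ ih =>
    rw [LinearMap.sum_apply]
    exact sum_mem fun k _ => ih k (mapB_mem_schmidtCone (hcp k) hX)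

theorem trace_mapB [Fintype a] [Fintype b] [Fintype b'] (E : Op b →ₗ[ℂ] Op b')
    (X : Op (a × b)) :
    (mapB a E X).trace = ∑ i, (E (Matrix.of fun j l => X (i, j) (i, l))).trace := by
  simp only [Matrix.trace, Matrix.diag]
  rw [Fintype.sum_prod_type]
  rfl

theorem trace_mapA [Fintype a] [Fintype b] [Fintype a'] (E : Op a →ₗ[ℂ] Op a')
    (X : Op (a × b)) :
    (mapA b E X).trace = ∑ i, (E (Matrix.of fun j l => X (j, i) (l, i))).trace := by
  simp only [Matrix.trace, Matrix.diag]
  rw [Fintype.sum_prod_type_right]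
  rfl

theorem IsLOCC.trace_eq [Fintype a] [Fintype b] [Fintype a'] [Fintype b']
    {Γ : Op (a × b) →ₗ[ℂ] Op (a' × b')} (hΓ : IsLOCC Γ) (X : Op (a × b)) :
    (Γ X).trace = X.trace := by
  induction hΓ with
  | done => rfl
  | alice K E hcp htp Γ hΓ ih =>
    rw [LinearMap.sum_apply, Matrix.trace_sum]
    simp only [LinearMap.comp_apply, ih, trace_mapA]
    rw [Finset.sum_comm]
    simp only [htp]
    simp only [Matrix.trace, Matrix.diag]
    rw [Fintype.sum_prod_type_right]
    rfl
  | bob K E hcp htp Γ hΓ ih =>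
    rw [LinearMap.sum_apply, Matrix.trace_sum]
    simp only [LinearMap.comp_apply, ih, trace_mapB]
    rw [Finset.sum_comm]
    simp only [htp]
    simp only [Matrix.trace, Matrix.diag]
    rw [Fintype.sum_prod_type]
    rfl

/-- Expanding each rank-one term in the standard basis of the first factor uses at most
`Fintype.card a` product terms. -/
theorem posSemidef_mem_schmidtCone [Fintype a] [Fintype b] (hk : Fintype.card a = k)
    {X : Op (a × b)} (hX : X.PosSemidef) : X ∈ schmidtCone k a b := by
  classical
  subst hk
  let e := Fintype.equivFin a
  obtain ⟨B, hB⟩ := exists_sum_of_posSemidef hX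
  have h : X = ∑ l, Matrix.of fun p q : a × b => B l p * star (B l q) := by
    ext p q
    rw [hB, Matrix.sum_apply]
    rfl
  rw [h]
  refine sum_mem fun l _ => AddSubmonoid.subset_closure
    ⟨fun i s => if e i = s then 1 else 0, fun s j => B l (e.symm s, j), fun p q => ?_⟩
  simp

/-- `⟨φ| X |φ⟩` for the unnormalised maximally entangled vector `φ = ∑ i, |i i⟩`. -/
def maxEntOverlap [Fintype a] (X : Op (a × a)) : ℂ := ∑ i, ∑ j, X (i, i) (j, j)

/-- On a generator, the vector is a matrix $M=UW$ of rank at most `k`, and the claim is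
`norm_trace_sq_le_rank_mul`. Both sides are additive, so the bound extends to the cone. -/
theorem re_maxEntOverlap_le [Fintype a] {X : Op (a × a)} (hX : X ∈ schmidtCone k a a) :
    (maxEntOverlap X).re ≤ k * X.trace.re := by
  classical
  induction hX using AddSubmonoid.closure_induction with
  | mem X hX =>
    obtain ⟨U, W, h⟩ := hX
    let M : Op a := Matrix.of U * Matrix.of W
    have hM : ∀ i j, ∑ s, U i s * W s j = M i j := fun i j => by simp [M, Matrix.mul_apply]
    simp only [hM] at h
    have h1 : maxEntOverlap X = ((‖M.trace‖ ^ 2 : ℝ) : ℂ) := by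
      rw [Complex.ofReal_pow, ← Complex.mul_conj']
      simp only [maxEntOverlap, h, ← Finset.mul_sum, ← Finset.sum_mul, ← star_sum]
      rfl
    have h2 : X.trace = (Mᴴ * M).trace := by
      simp only [Matrix.trace, Matrix.diag, Matrix.mul_apply, Matrix.conjTranspose_apply, h]
      rw [Fintype.sum_prod_type_right]
      exact Finset.sum_congr rfl fun i _ => Finset.sum_congr rfl fun j _ => mul_comm _ _
    have h3 : M.rank ≤ k :=
      (Matrix.rank_mul_le_left _ _).trans (by simpa using Matrix.rank_le_card_width (Matrix.of U))
    rw [h1, h2, Complex.ofReal_re]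
    refine (norm_trace_sq_le_rank_mul M).trans ?_
    have h4 : 0 ≤ (Mᴴ * M).trace.re :=
      (Complex.le_def.1 (Matrix.posSemidef_conjTranspose_mul_self M).trace_nonneg).1
    gcongr
  | zero => simp [maxEntOverlap]
  | add X Y _ _ h1 h2 =>
    have : maxEntOverlap (X + Y) = maxEntOverlap X + maxEntOverlap Y := by
      simp [maxEntOverlap, Finset.sum_add_distrib]
    rw [this, Matrix.trace_add, Complex.add_re, Complex.add_re, mul_add]
    exact add_le_add h1 h2

end Schmidt

/-! ### Maximally entangled states -/

section MaxEnt

theorem bip_apply {ι κ : Type} (X : QOp (ι ⊕ κ)) (p q : (ι → Bool) × (κ → Bool)) :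
    bip ι κ X p q = X (Sum.elim p.1 p.2) (Sum.elim q.1 q.2) := rfl

theorem sum_sum_elim {ι κ : Type} [Fintype ι] [Fintype κ] [DecidableEq ι] [DecidableEq κ]
    (G : (ι ⊕ κ → Bool) → ℂ) :
    ∑ x, G x = ∑ p : (ι → Bool) × (κ → Bool), G (Sum.elim p.1 p.2) :=
  ((Equiv.sumArrowEquivProdArrow ι κ Bool).symm.sum_comp G).symm

theorem trace_bip {ι κ : Type} [Fintype ι] [Fintype κ] [DecidableEq ι] [DecidableEq κ]
    (X : QOp (ι ⊕ κ)) : (bip ι κ X).trace = X.trace :=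
  (sum_sum_elim fun x => X x x).symm

theorem posSemidef_bip {ι κ : Type} {X : QOp (ι ⊕ κ)} (hX : X.PosSemidef) :
    (bip ι κ X).PosSemidef := hX.submatrix _

theorem eprVec_elim (m : ℕ) (u v : Fin m → Bool) :
    eprVec m (Sum.elim u v) = if u = v then ((1 / √2 : ℝ) : ℂ) ^ m else 0 := by
  simp only [eprVec, Sum.elim_inl, Sum.elim_inr]
  split_ifs with h
  · subst h; simp
  · obtain ⟨i, hi⟩ := Function.ne_iff.1 h
    exact Finset.prod_eq_zero (Finset.mem_univ i) (if_neg hi)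

theorem star_eprVec (m : ℕ) : star (eprVec m) = eprVec m := by
  ext x
  simp only [Pi.star_apply, eprVec, star_prod]
  refine Finset.prod_congr rfl fun i _ => ?_
  split_ifs <;> simp

theorem inv_sqrt_two_pow_mul_self (m : ℕ) :
    ((1 / √2 : ℝ) : ℂ) ^ m * ((1 / √2 : ℝ) : ℂ) ^ m = (1 / 2) ^ m := by
  rw [← mul_pow, inv_sqrt_two_mul_self]

theorem eprVec_dotProduct (m : ℕ) (R : QOp (Fin m ⊕ Fin m)) :
    star (eprVec m) ⬝ᵥ (R *ᵥ eprVec m) = (1 / 2) ^ m * maxEntOverlap (bip (Fin m) (Fin m) R) := by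
  simp only [star_eprVec, dotProduct, Matrix.mulVec, sum_sum_elim, Fintype.sum_prod_type,
    eprVec_elim]
  simp only [ite_mul, zero_mul, mul_ite, mul_zero, Finset.sum_ite_eq, Finset.mem_univ, if_true]
  simp only [maxEntOverlap, bip_apply, Finset.mul_sum]
  refine Finset.sum_congr rfl fun u _ => Finset.sum_congr rfl fun v _ => ?_
  rw [← inv_sqrt_two_pow_mul_self]
  ring

theorem pErr_eq {ι : Type} {m : ℕ} (Γ : QOp ι →ₗ[ℂ] QOp (Fin m ⊕ Fin m)) (ρ : QOp ι) :
    pErr Γ ρ = 1 - (1 / 2) ^ m * (maxEntOverlap (bip (Fin m) (Fin m) (Γ ρ))).re := by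
  rw [pErr, eprVec_dotProduct,
    show ((1 / 2 : ℂ)) ^ m = (((1 / 2 : ℝ) ^ m : ℝ) : ℂ) by push_cast; rfl, Complex.re_ofReal_mul]

theorem eprVec_norm (m : ℕ) : star (eprVec m) ⬝ᵥ eprVec m = 1 := by
  have h := eprVec_dotProduct m 1
  rw [Matrix.one_mulVec] at h
  rw [h]
  have : maxEntOverlap (bip (Fin m) (Fin m) 1) = 2 ^ m := by
    simp only [maxEntOverlap, bip_apply, Matrix.one_apply]
    have : ∀ i j : Fin m → Bool, Sum.elim i i = Sum.elim j j ↔ i = j :=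
      fun i j => ⟨fun h => by simpa using congrArg (· ∘ Sum.inl) h, fun h => by rw [h]⟩
    simp [this]
  rw [this, ← mul_pow]
  norm_num

theorem trace_mul_epr (m : ℕ) (R : QOp (Fin m ⊕ Fin m)) :
    (R * epr m).trace = star (eprVec m) ⬝ᵥ (R *ᵥ eprVec m) := by
  rw [epr, Matrix.mul_vecMulVec, Matrix.trace_vecMulVec, dotProduct_comm]

theorem isDensity_epr (m : ℕ) : IsDensity (epr m) := by
  refine ⟨Matrix.posSemidef_vecMulVec_self_star _, ?_⟩
  have h := trace_mul_epr m 1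
  rwa [one_mul, Matrix.one_mulVec, eprVec_norm] at h

theorem epr_mul_self (m : ℕ) : epr m * epr m = epr m := by
  rw [epr, Matrix.vecMulVec_mul_vecMulVec, eprVec_norm, one_smul]

/-- The unit vector `2^{-n/2} ∑ i, |i i⟩`. -/
def maxEntVec (n : ℕ) : EuclideanSpace ℂ ((Fin n → Bool) × (Fin n → Bool)) :=
  WithLp.toLp 2 fun p => eprVec n (Sum.elim p.1 p.2)

theorem inner_maxEntVec (n : ℕ) (M : Op ((Fin n → Bool) × (Fin n → Bool))) :
    inner ℂ (maxEntVec n) (M.toEuclideanLin (maxEntVec n)) = (1 / 2) ^ n * maxEntOverlap M := by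
  have h := eprVec_dotProduct n ((bip (Fin n) (Fin n)).symm M)
  rw [LinearEquiv.apply_symm_apply] at h
  rw [← h, EuclideanSpace.inner_eq_star_dotProduct, dotProduct_comm]
  simp only [dotProduct, sum_sum_elim, Matrix.toLpLin_apply, Matrix.mulVec]
  rfl

theorem norm_maxEntVec (n : ℕ) : ‖maxEntVec n‖ ≤ 1 := by
  have h1 : inner ℂ (maxEntVec n) (maxEntVec n) = 1 := by
    rw [← eprVec_norm n, EuclideanSpace.inner_eq_star_dotProduct, dotProduct_comm]
    simp only [dotProduct, sum_sum_elim]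
    rfl
  rw [inner_self_eq_norm_sq_to_K] at h1
  have h2 : ‖maxEntVec n‖ ^ 2 = 1 := Complex.ofReal_injective (by simpa using h1)
  nlinarith [norm_nonneg (maxEntVec n)]

theorem maxEntOverlap_bip_epr (n : ℕ) :
    (1 / 2) ^ n * maxEntOverlap (bip (Fin n) (Fin n) (epr n)) = 1 := by
  rw [← eprVec_dotProduct, ← trace_mul_epr, epr_mul_self, (isDensity_epr n).2]

theorem traceNorm_bip_epr (n : ℕ) : traceNorm (bip (Fin n) (Fin n) (epr n)) = 1 := by
  have hmul : ∀ X Y : QOp (Fin n ⊕ Fin n), bip (Fin n) (Fin n) X * bip (Fin n) (Fin n) Y =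
      bip (Fin n) (Fin n) (X * Y) := fun X Y => Matrix.submatrix_mul_equiv X Y _ _ _
  have hepr := isDensity_epr n
  rw [traceNorm_of_isProj (posSemidef_bip hepr.1).isHermitian (by rw [hmul, epr_mul_self]),
    trace_bip, hepr.2, Complex.one_re]

theorem re_maxEntOverlap_nonneg {a : Type} [Fintype a] {X : Op (a × a)} (hX : X.PosSemidef) :
    0 ≤ (maxEntOverlap X).re := by
  classical
  have h := hX.re_dotProduct_nonneg fun p => if p.1 = p.2 then 1 else 0
  have h2 : (star (fun p : a × a => if p.1 = p.2 then (1 : ℂ) else 0) ⬝ᵥ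
      (X *ᵥ fun p => if p.1 = p.2 then 1 else 0)) = maxEntOverlap X := by
    simp [dotProduct, Matrix.mulVec, Fintype.sum_prod_type, maxEntOverlap, apply_ite star]
  rw [h2] at h
  exact h

end MaxEnt

/-! ### The one-shot distillable entanglement -/

section OneShot

variable {nA nB : ℕ}

theorem distillable_le {ρ : QOp (Fin nA ⊕ Fin nB)} (hρ : IsDensity ρ) {ε : ℝ} (hε : ε < 1 / 2) :
    distillable ε ρ ≤ (nA : ℕ∞) := by
  refine iSup₂_le fun m ⟨Γ, hΓ, herr⟩ => ?_
  rw [Nat.cast_le]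
  by_contra! hm
  rw [pErr_eq] at herr
  simp only [LinearMap.comp_apply, LinearEquiv.coe_coe, LinearEquiv.apply_symm_apply] at herr
  have h1 := re_maxEntOverlap_le (hΓ.mem_schmidtCone
    (posSemidef_mem_schmidtCone (k := 2 ^ nA) (by simp) (posSemidef_bip hρ.1)))
  rw [hΓ.trace_eq, trace_bip, hρ.2, Complex.one_re, mul_one] at h1
  have h2 : (1 / 2 : ℝ) ^ m * (maxEntOverlap (Γ (bip (Fin nA) (Fin nB) ρ))).re ≤ 1 / 2 :=
    calc (1 / 2 : ℝ) ^ m * (maxEntOverlap (Γ (bip (Fin nA) (Fin nB) ρ))).re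
        ≤ (1 / 2) ^ m * ((2 ^ nA : ℕ) : ℝ) := by gcongr
      -- One pair too many already halves the fidelity, which is where the threshold `1 / 2` for the
      -- error comes from.
      _ ≤ (1 / 2) ^ (nA + 1) * ((2 ^ nA : ℕ) : ℝ) := by
          gcongr ?_ * _
          exact pow_le_pow_of_le_one (by norm_num) (by norm_num) hm
      _ = 1 / 2 := by
          rw [pow_succ, mul_right_comm, Nat.cast_pow, ← mul_pow]
          norm_num
  linarith

theorem isLOCC_mapB {a b b' : Type} [Fintype a] [Fintype b] [Fintype b']
    {E : Op b →ₗ[ℂ] Op b'} (hE : IsChannel E) : IsLOCC (mapB a E) := by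
  have h := IsLOCC.bob (a := a) 1 (fun _ => E) (fun _ => hE.1) (fun X => by simpa using hE.2 X)
    (fun _ => LinearMap.id) fun _ => IsLOCC.done
  simpa using h

/-- Bob applies `D` in a protocol with one step. The error is clamped to `[0, 1]` because `δ` is an
arbitrary real, while the error function in the main theorem has values in this interval. -/
theorem le_distillable_of_channel {n l : ℕ} {C : QOp (Fin n) →ₗ[ℂ] QOp (Fin l)}
    {D : QOp (Fin l) →ₗ[ℂ] QOp (Fin n)} (hD : IsChannel D) {δ : ℝ}
    (hδ : diamondNorm (D ∘ₗ C - LinearMap.id) ≤ ENNReal.ofReal δ)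
    (hρ : IsDensity (onB (Fin n) C (epr n))) :
    (n : ℕ∞) ≤ distillable (min 1 (max 0 δ)) (onB (Fin n) C (epr n)) := by
  refine le_iSup₂_of_le n ⟨mapB _ D, isLOCC_mapB hD, ?_⟩ le_rfl
  rw [pErr_eq]
  simp only [LinearMap.comp_apply, LinearEquiv.coe_coe, LinearEquiv.apply_symm_apply]
  set X := bip (Fin n) (Fin n) (epr n) with hX
  have h0 : mapB (Fin n → Bool) D (bip (Fin n) (Fin l) (onB (Fin n) C (epr n))) =
      X + mapB (Fin n → Bool) (D ∘ₗ C - LinearMap.id) X := by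
    have : mapB (Fin n → Bool) D (bip (Fin n) (Fin l) (onB (Fin n) C (epr n))) =
        mapB (Fin n → Bool) (D ∘ₗ C) X := rfl
    rw [this]
    ext p q
    change D (C _) p.2 q.2 = _ + (D (C _) p.2 q.2 - X p q)
    rw [add_sub_cancel]
  -- The bound by 1 is nonnegativity of the fidelity; the other bound comes from the diamond norm.
  refine le_min ?_ ?_
  · have := re_maxEntOverlap_nonneg (posSemidef_mapB (a := Fin n → Bool) hD.1
      (posSemidef_bip hρ.1))
    have h2 : (0 : ℝ) ≤ (1 / 2) ^ n := by positivity
    nlinarith [mul_nonneg h2 this]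
  · set Y := mapB (Fin n → Bool) (D ∘ₗ C - LinearMap.id) X with hY
    have h1 : traceNorm Y ≤ max 0 δ := by
      have h2 : ENNReal.ofReal (traceNorm Y) ≤ ENNReal.ofReal δ :=
        (le_iSup₂_of_le (f := fun (X : Op ((Fin n → Bool) × (Fin n → Bool)))
          (_ : traceNorm X ≤ 1) => ENNReal.ofReal (traceNorm (mapB (Fin n → Bool)
            (D ∘ₗ C - LinearMap.id) X))) X (traceNorm_bip_epr n).le le_rfl).trans hδ
      -- For `δ ≤ 0`, `ENNReal.ofReal` truncates to 0, so the trace norm is at most 0.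
      rcases le_total 0 δ with h | h
      · rw [ENNReal.ofReal_le_ofReal_iff h] at h2
        exact h2.trans (le_max_right _ _)
      · rw [ENNReal.ofReal_of_nonpos h, nonpos_iff_eq_zero, ENNReal.ofReal_eq_zero] at h2
        exact h2.trans (le_max_left _ _)
    have h3 := norm_inner_le_traceNorm Y (maxEntVec n) (norm_maxEntVec n)
    rw [inner_maxEntVec] at h3
    have h4 : ((1 / 2 : ℂ)) ^ n * maxEntOverlap (X + Y) =
        1 + (1 / 2) ^ n * maxEntOverlap Y := by
      have hadd : maxEntOverlap (X + Y) = maxEntOverlap X + maxEntOverlap Y := by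
        simp [maxEntOverlap, Finset.sum_add_distrib]
      rw [hadd, mul_add, hX, maxEntOverlap_bip_epr]
    have h5 : (1 / 2 : ℝ) ^ n * (maxEntOverlap (X + Y)).re =
        1 + ((1 / 2) ^ n * maxEntOverlap Y).re := by
      rw [← Complex.one_re, ← Complex.add_re, ← h4, ← Complex.re_ofReal_mul]
      push_cast
      rfl
    rw [h0, h5]
    have h6 := (abs_le.1 (Complex.abs_re_le_norm ((1 / 2) ^ n * maxEntOverlap Y))).1
    linarith

end OneShot

/-! ### Preparation of EPR pairs -/

section EprCircuit

/-- The circuit that turns the qubit pair `i` from `|00⟩` into `|Φ⟩`. -/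
def eprStep {n : ℕ} (i : Fin n) : Circuit (Fin n ⊕ Fin n) :=
  [.h (Sum.inl i), .cnot (Sum.inl i) (Sum.inr i) Sum.inl_ne_inr]

/-- The circuit that prepares `|Φ⟩^{⊗ n}` from `|0…0⟩`. -/
def eprCircuit (n : ℕ) : Circuit (Fin n ⊕ Fin n) := (List.finRange n).flatMap eprStep

theorem eprCircuit_length (n : ℕ) : (eprCircuit n).length = n * 2 := by
  simp [eprCircuit, eprStep, List.length_flatMap]

theorem eprCircuit_noT (n : ℕ) : ∀ g ∈ eprCircuit n, g.NoT := by
  intro g hg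
  simp only [eprCircuit, eprStep, List.mem_flatMap, List.mem_cons, List.not_mem_nil, or_false] at hg
  obtain ⟨i, -, rfl | rfl⟩ := hg <;> trivial

/-- The state vector with the pairs in `s` in the state `|Φ⟩` and all others in `|00⟩`. -/
def eprPartial {n : ℕ} (s : Finset (Fin n)) (x : Fin n ⊕ Fin n → Bool) : ℂ :=
  ∏ i, if i ∈ s then (if x (Sum.inl i) = x (Sum.inr i) then ((1 / √2 : ℝ) : ℂ) else 0)
    else if x (Sum.inl i) = false ∧ x (Sum.inr i) = false then 1 else 0

theorem star_eprPartial {n : ℕ} (s : Finset (Fin n)) (x : Fin n ⊕ Fin n → Bool) :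
    star (eprPartial s x) = eprPartial s x := by
  simp only [eprPartial, star_prod]
  refine Finset.prod_congr rfl fun i _ => ?_
  split_ifs <;> simp

theorem eprPartial_update_true {n : ℕ} {s : Finset (Fin n)} {i : Fin n} (hi : i ∉ s)
    (x : Fin n ⊕ Fin n → Bool) : eprPartial s (Function.update x (Sum.inl i) true) = 0 :=
  Finset.prod_eq_zero (Finset.mem_univ i) (by simp [hi])

/-- This is Hadamard followed by `CNOT` on amplitudes: `x` is pulled back through the `CNOT`, and
only the branch in which the control was 0 contributes, by `eprPartial_update_true`. -/
theorem eprPartial_insert {n : ℕ} {s : Finset (Fin n)} {i : Fin n} (hi : i ∉ s)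
    (x : Fin n ⊕ Fin n → Bool) :
    ((1 / √2 : ℝ) : ℂ) * eprPartial s (Function.update (Function.update x (Sum.inr i)
      (xor (x (Sum.inr i)) (x (Sum.inl i)))) (Sum.inl i) false) = eprPartial (insert i s) x := by
  simp only [eprPartial]
  rw [← Finset.mul_prod_erase Finset.univ _ (Finset.mem_univ i),
    ← Finset.mul_prod_erase Finset.univ (fun j => if j ∈ insert i s then _ else _)
      (Finset.mem_univ i), ← mul_assoc]
  congr 1
  · simp only [hi, if_false, Finset.mem_insert_self, if_true]
    cases x (Sum.inl i) <;> cases x (Sum.inr i) <;> simp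
  · refine Finset.prod_congr rfl fun j hj => ?_
    have hj' : j ≠ i := Finset.ne_of_mem_erase hj
    simp [hj', Finset.mem_insert]

theorem run_eprStep {n : ℕ} {s : Finset (Fin n)} {i : Fin n} (hi : i ∉ s) :
    Circuit.run (eprStep i) (Matrix.vecMulVec (eprPartial s) (star (eprPartial s))) =
      Matrix.vecMulVec (eprPartial (insert i s)) (star (eprPartial (insert i s))) := by
  ext x y
  change (Gate.cnot (Sum.inl i) (Sum.inr i) Sum.inl_ne_inr).run ((Gate.h (Sum.inl i)).run _) x y = _
  rw [Gate.run_classical_apply (by trivial), run_h_apply]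
  simp only [Matrix.vecMulVec_apply, Pi.star_apply, star_eprPartial, Fintype.sum_bool,
    eprPartial_update_true hi, mul_zero, zero_mul, zero_add, Bool.and_false]
  rw [← eprPartial_insert hi x, ← eprPartial_insert hi y, ← inv_sqrt_two_mul_self]
  simp only [sgn, Bool.false_eq_true, if_false, one_mul, Gate.perm]
  ring

theorem run_eprStep_flatMap {n : ℕ} (L : List (Fin n)) (hL : L.Nodup) (s : Finset (Fin n))
    (hs : ∀ i ∈ L, i ∉ s) :
    Circuit.run (L.flatMap eprStep) (Matrix.vecMulVec (eprPartial s) (star (eprPartial s))) =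
      Matrix.vecMulVec (eprPartial (s ∪ L.toFinset)) (star (eprPartial (s ∪ L.toFinset))) := by
  induction L generalizing s with
  | nil => simp [Circuit.run]
  | cons i L ih =>
    rw [List.nodup_cons] at hL
    rw [List.flatMap_cons, run_append, run_eprStep (hs i (by simp)), ih hL.2]
    · simp [Finset.insert_union, Finset.union_insert]
    · intro j hj
      rw [Finset.mem_insert, not_or]
      exact ⟨fun h => hL.1 (h ▸ hj), hs j (by simp [hj])⟩

theorem run_eprCircuit (n : ℕ) : Circuit.run (eprCircuit n) (zeroState _) = epr n := by
  classical
  have h0 : zeroState (Fin n ⊕ Fin n) =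
      Matrix.vecMulVec (eprPartial ∅) (star (eprPartial ∅)) := by
    have h : ∀ x : Fin n ⊕ Fin n → Bool,
        eprPartial ∅ x = if ∀ i, x i = false then (1 : ℂ) else 0 := by
      intro x
      simp only [eprPartial, Finset.notMem_empty, if_false, Finset.prod_boole, Sum.forall,
        Finset.mem_univ, true_imp_iff, forall_and]
    ext x y
    rw [Matrix.vecMulVec_apply, Pi.star_apply, h, h]
    simp only [zeroState, Matrix.of_apply]
    split_ifs <;> first | (exfalso; tauto) | simp
  have h1 : eprPartial (Finset.univ : Finset (Fin n)) = eprVec n := by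
    ext x
    simp [eprPartial, eprVec]
  rw [eprCircuit, h0, run_eprStep_flatMap _ (List.nodup_finRange n) _ (by simp),
    List.toFinset_finRange, Finset.empty_union, h1, epr]

end EprCircuit

/-! ### Operations on one part of a register -/

section OnPart

variable {ι κ κ' τ : Type}

theorem extend_inr (u : κ → Bool) (x : ι ⊕ κ → Bool) :
    Function.extend (Function.Embedding.inr : κ ↪ ι ⊕ κ) u x = Sum.elim (x ∘ Sum.inl) u := by
  symm
  rw [eq_extend_iff]
  refine ⟨rfl, ?_⟩
  rintro (j | j) hj
  · rfl
  · exact absurd ⟨j, rfl⟩ hj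

theorem onB_apply (E : QOp κ →ₗ[ℂ] QOp κ') (X : QOp (ι ⊕ κ)) (x y : ι ⊕ κ' → Bool) :
    onB ι E X x y = E (Matrix.of fun u v => X (Sum.elim (x ∘ Sum.inl) u)
      (Sum.elim (y ∘ Sum.inl) v)) (x ∘ Sum.inr) (y ∘ Sum.inr) := rfl

theorem slice_inr (x y : ι ⊕ κ → Bool) (X : QOp (ι ⊕ κ)) :
    slice Function.Embedding.inr x y X = Matrix.of fun u v =>
      X (Sum.elim (x ∘ Sum.inl) u) (Sum.elim (y ∘ Sum.inl) v) := by
  ext u v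
  rw [slice_apply, extend_inr, extend_inr, Matrix.of_apply]

/-- The blocks along `inr` are exactly the operators to which `mapB` applies its argument. -/
theorem run_map_inr [DecidableEq ι] [Fintype ι] [DecidableEq κ] [Fintype κ] (c : Circuit κ)
    (X : QOp (ι ⊕ κ)) :
    Circuit.run (c.map (Gate.map Function.Embedding.inr)) X = onB ι (Circuit.run c) X := by
  ext x y
  refine (apply_eq_slice Function.Embedding.inr x y _).trans ?_
  rw [slice_run, onB_apply, slice_inr]
  rfl

theorem offZero_sumMap {ι' : Type} (f : ι ↪ ι') (g : κ ↪ κ') (x : ι' ⊕ κ' → Bool) :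
    offZero (Function.Embedding.sumMap f g) x =
      offZero f (x ∘ Sum.inl) * offZero g (x ∘ Sum.inr) := by
  classical
  have : (∀ j, j ∉ Set.range (Function.Embedding.sumMap f g) → x j = false) ↔
      (∀ j, j ∉ Set.range f → (x ∘ Sum.inl) j = false) ∧
        ∀ j, j ∉ Set.range g → (x ∘ Sum.inr) j = false := by
    simp [Sum.forall]
  simp only [offZero, this]
  split_ifs <;> first | (exfalso; tauto) | simp

theorem offZero_refl (x : ι → Bool) : offZero (Function.Embedding.refl ι) x = 1 := by
  simp [offZero]

theorem initReg_sumMap_refl (g : κ ↪ κ') (X : QOp (ι ⊕ κ)) :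
    initReg (Function.Embedding.sumMap (Function.Embedding.refl ι) g) X = onB ι (initReg g) X := by
  ext x y
  rw [onB_apply, initReg_apply_mul, initReg_apply_mul, offZero_sumMap, offZero_sumMap,
    offZero_refl, offZero_refl, one_mul, one_mul, Matrix.of_apply]
  have h : ∀ x : ι ⊕ κ' → Bool, x ∘ Function.Embedding.sumMap (Function.Embedding.refl ι) g =
      Sum.elim (x ∘ Sum.inl) ((x ∘ Sum.inr) ∘ g) := by
    intro x
    ext (j | j) <;> rfl
  rw [h x, h y]

theorem onB_initReg_sumMap {ι' : Type} (f : ι ↪ ι') (E : QOp κ →ₗ[ℂ] QOp κ') (X : QOp (ι ⊕ κ)) :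
    onB ι' E (initReg (Function.Embedding.sumMap f (Function.Embedding.refl κ)) X) =
      initReg (Function.Embedding.sumMap f (Function.Embedding.refl κ')) (onB ι E X) := by
  ext x y
  rw [onB_apply, initReg_apply_mul, offZero_sumMap, offZero_sumMap, offZero_refl, offZero_refl,
    mul_one, mul_one, onB_apply]
  have h : (Matrix.of fun u v => initReg (Function.Embedding.sumMap f (Function.Embedding.refl κ)) X
      (Sum.elim (x ∘ Sum.inl) u) (Sum.elim (y ∘ Sum.inl) v)) =
      (offZero f (x ∘ Sum.inl) * star (offZero f (y ∘ Sum.inl))) •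
        (Matrix.of fun u v => X (Sum.elim ((x ∘ Sum.inl) ∘ f) u)
          (Sum.elim ((y ∘ Sum.inl) ∘ f) v) : QOp κ) := by
    have h1 : ∀ (w : ι' → Bool) (u : κ → Bool),
        Sum.elim w u ∘ Function.Embedding.sumMap f (Function.Embedding.refl κ) =
          Sum.elim (w ∘ f) u := by
      intro w u
      ext (j | j) <;> rfl
    ext u v
    rw [Matrix.of_apply, initReg_apply_mul, offZero_sumMap, offZero_sumMap, offZero_refl,
      offZero_refl, mul_one, mul_one, h1, h1]
    rfl
  rw [h, map_smul, Matrix.smul_apply, smul_eq_mul]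
  rfl

theorem extend_sumMap {ι' : Type} (f : ι ↪ ι') (g : κ ↪ κ') (u : ι ⊕ κ → Bool)
    (x : ι' ⊕ κ' → Bool) :
    Function.extend (Function.Embedding.sumMap f g) u x =
      Sum.elim (Function.extend f (u ∘ Sum.inl) (x ∘ Sum.inl))
        (Function.extend g (u ∘ Sum.inr) (x ∘ Sum.inr)) := by
  symm
  rw [eq_extend_iff]
  constructor
  · ext (j | j)
    · exact extend_apply_emb f _ _ j
    · exact extend_apply_emb g _ _ j
  · rintro (j | j) hj
    · exact (extend_apply_of_notMem f (u ∘ Sum.inl) (x ∘ Sum.inl)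
        fun ⟨i, hi⟩ => hj ⟨Sum.inl i, congrArg _ hi⟩).symm
    · exact (extend_apply_of_notMem g (u ∘ Sum.inr) (x ∘ Sum.inr)
        fun ⟨i, hi⟩ => hj ⟨Sum.inr i, congrArg _ hi⟩).symm

theorem extend_refl (u x : ι → Bool) : Function.extend (Function.Embedding.refl ι) u x = u := by
  symm
  rw [eq_extend_iff]
  exact ⟨rfl, fun j hj => absurd ⟨j, rfl⟩ hj⟩

variable [DecidableEq ι] [Fintype ι] [DecidableEq κ] [Fintype κ] [DecidableEq κ'] [Fintype κ']
  [DecidableEq τ] [Fintype τ]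

theorem reduceReg_sumMap_refl (g : κ ↪ κ') (X : QOp (ι ⊕ κ')) :
    reduceReg (Function.Embedding.sumMap (Function.Embedding.refl ι) g) X =
      onB ι (reduceReg g) X := by
  ext u v
  rw [onB_apply, reduceReg_apply, reduceReg_apply, sum_sum_elim, Fintype.sum_prod_type]
  simp only [extend_sumMap, extend_refl, Sum.elim_comp_inr, Matrix.of_apply, Finset.sum_const,
    Finset.card_univ, Fintype.card_sum, Fintype.card_fun, Fintype.card_bool, nsmul_eq_mul, pow_add,
    Nat.cast_pow, Nat.cast_ofNat]
  have h2 : (2 : ℂ) ^ Fintype.card ι ≠ 0 := pow_ne_zero _ two_ne_zero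
  field_simp

/-- The circuit that prepares EPR pairs and applies a channel to the second halves. -/
theorem exists_channelCircuit_onB_epr {n l : ℕ} (c : ChannelCircuit (Fin n) (Fin l)) :
    ∃ d : ChannelCircuit (Fin 0) (Fin n ⊕ Fin l), d.size = 4 * n + c.size ∧
      d.run (zeroState (Fin 0)) = onB (Fin n) c.run (epr n) := by
  let e : Fin n ⊕ (Fin n ⊕ Fin c.anc) ≃ Fin (n + (n + c.anc)) :=
    (Equiv.sumCongr (Equiv.refl _) finSumFinEquiv).trans finSumFinEquiv
  -- The input register is empty, so both halves of the pairs and the ancillas of `c` all lie among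
  -- the new ancillas.
  let F : Fin n ⊕ (Fin n ⊕ Fin c.anc) ↪ Fin 0 ⊕ Fin (n + (n + c.anc)) :=
    e.toEmbedding.trans Function.Embedding.inr
  let g : Fin n ⊕ Fin n ↪ Fin n ⊕ (Fin n ⊕ Fin c.anc) :=
    Function.Embedding.sumMap (Function.Embedding.refl _) Function.Embedding.inl
  let d : ChannelCircuit (Fin 0) (Fin n ⊕ Fin l) :=
    { anc := n + (n + c.anc)
      circ := ((eprCircuit n).map (Gate.map g) ++
        c.circ.map (Gate.map Function.Embedding.inr)).map (Gate.map F)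
      out := (Function.Embedding.sumMap (Function.Embedding.refl _) c.out).trans F }
  refine ⟨d, ?_, ?_⟩
  · simp only [d, ChannelCircuit.size, List.length_map, List.length_append, eprCircuit_length]
    ring
  · change reduceReg d.out (Circuit.run d.circ (initReg _ (zeroState (Fin 0)))) = _
    rw [initReg_zeroState, ← initReg_zeroState F, run_map_initReg, reduceReg_trans,
      reduceReg_initReg, run_append, ← initReg_zeroState g, run_map_initReg, run_eprCircuit,
      run_map_inr, reduceReg_sumMap_refl, initReg_sumMap_refl]
    rfl

end OnPart

/-! ### Separable states under circuit protocols -/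

section Separable

variable {ι κ τ : Type}

/-- The cone generated by the product vectors `α ⊗ β`, with `α` on the qubits `f` and `β` on the
qubits `g`. -/
def productCone (f : ι ↪ κ) (g : τ ↪ κ) : AddSubmonoid (QOp κ) :=
  AddSubmonoid.closure {X | ∃ (α : (ι → Bool) → ℂ) (β : (τ → Bool) → ℂ), ∀ x y,
    X x y = (α (x ∘ f) * β (x ∘ g)) * star (α (y ∘ f) * β (y ∘ g))}

/-- The block of a product vector along `f` is a multiple of $\alpha\alpha^\dagger$, so the circuit
acts on $\alpha$ alone; its positive semidefinite image splits into rank-one terms and $\beta$ is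
untouched. -/
theorem run_map_mem_productCone [DecidableEq ι] [Fintype ι] [DecidableEq κ] [Fintype κ]
    {f : ι ↪ κ} {g : τ ↪ κ} (hfg : ∀ i j, f i ≠ g j) (c : Circuit ι) {X : QOp κ}
    (hX : X ∈ productCone f g) : Circuit.run (c.map (Gate.map f)) X ∈ productCone f g := by
  induction hX using AddSubmonoid.closure_induction with
  | mem X hX =>
    obtain ⟨α, β, h⟩ := hX
    obtain ⟨B, hB⟩ := exists_sum_of_posSemidef
      (posSemidef_run c (Matrix.posSemidef_vecMulVec_self_star α))
    have h1 : Circuit.run (c.map (Gate.map f)) X = ∑ k, Matrix.of fun x y =>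
        (B k (x ∘ f) * β (x ∘ g)) * star (B k (y ∘ f) * β (y ∘ g)) := by
      ext x y
      have h2 : slice f x y X =
          (β (x ∘ g) * star (β (y ∘ g))) • Matrix.vecMulVec α (star α) := by
        ext u v
        rw [slice_apply, h, extend_comp_emb, extend_comp_emb, extend_comp_disjoint f g hfg,
          extend_comp_disjoint f g hfg, Matrix.smul_apply, Matrix.vecMulVec_apply, star_mul',
          Pi.star_apply, smul_eq_mul]
        ring
      refine (apply_eq_slice f x y _).trans ?_
      rw [slice_run, h2, map_smul, Matrix.smul_apply, hB, Matrix.sum_apply, smul_eq_mul,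
        Finset.mul_sum]
      refine Finset.sum_congr rfl fun k _ => ?_
      rw [Matrix.of_apply, star_mul']
      ring
    rw [h1]
    exact sum_mem fun k _ => AddSubmonoid.subset_closure ⟨B k, β, fun x y => rfl⟩
  | zero => rw [map_zero]; exact zero_mem _
  | add X Y _ _ h1 h2 => rw [map_add]; exact add_mem h1 h2

theorem run_meas_list_apply [DecidableEq κ] [Fintype κ] (h : ι → κ) (L : List ι) (X : QOp κ)
    (x y : κ → Bool) : Circuit.run (L.map fun i => Gate.meas (h i)) X x y =
      open Classical in if ∀ i ∈ L, x (h i) = y (h i) then X x y else 0 := by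
  induction L generalizing X with
  | nil => simp [Circuit.run]
  | cons i L ih =>
    change Circuit.run (L.map fun i => Gate.meas (h i)) ((Gate.meas (h i)).run X) x y = _
    rw [ih, run_meas_apply]
    simp only [List.forall_mem_cons]
    split_ifs <;> first | rfl | (exfalso; tauto)

variable {A B C : Type}

/-- The qubits of the first party in the register `(A ⊕ B) ⊕ C`. -/
def onlyA (A B C : Type) : A ↪ (A ⊕ B) ⊕ C := Function.Embedding.inl.trans Function.Embedding.inl

/-- The qubits of the second party in the register `(A ⊕ B) ⊕ C`. -/
def onlyB (A B C : Type) : B ↪ (A ⊕ B) ⊕ C := Function.Embedding.inr.trans Function.Embedding.inl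

/-- The qubits of the first party and the communication qubits. -/
def withA (A B C : Type) : A ⊕ C ↪ (A ⊕ B) ⊕ C :=
  Function.Embedding.sumMap Function.Embedding.inl (Function.Embedding.refl _)

/-- The qubits of the second party and the communication qubits. -/
def withB (A B C : Type) : B ⊕ C ↪ (A ⊕ B) ⊕ C :=
  Function.Embedding.sumMap Function.Embedding.inr (Function.Embedding.refl _)

theorem withA_ne_onlyB (i : A ⊕ C) (j : B) : withA A B C i ≠ onlyB A B C j := by
  rcases i with i | i
  · exact fun h => Sum.inl_ne_inr (Sum.inl_injective h)
  · exact fun h => Sum.inr_ne_inl h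

theorem withB_ne_onlyA (i : B ⊕ C) (j : A) : withB A B C i ≠ onlyA A B C j := by
  rcases i with i | i
  · exact fun h => Sum.inr_ne_inl (Sum.inl_injective h)
  · exact fun h => Sum.inr_ne_inl h

theorem comp_withA (x : (A ⊕ B) ⊕ C → Bool) :
    x ∘ withA A B C = Sum.elim (x ∘ onlyA A B C) (x ∘ Sum.inr) := by
  ext (i | i) <;> rfl

theorem comp_withB (x : (A ⊕ B) ⊕ C → Bool) :
    x ∘ withB A B C = Sum.elim (x ∘ onlyB A B C) (x ∘ Sum.inr) := by
  ext (i | i) <;> rfl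

/-- A measurement of the communication qubits allows to hand them over to the other party. -/
theorem run_meas_mem_productCone [Fintype C] [DecidableEq C] [DecidableEq κ] [Fintype κ]
    {f : A ⊕ C ↪ κ} {g : B ⊕ C ↪ κ} {f' : A ↪ κ} {g' : B ↪ κ} {h : C ↪ κ}
    (hf : ∀ x : κ → Bool, x ∘ f = Sum.elim (x ∘ f') (x ∘ h))
    (hg : ∀ x : κ → Bool, x ∘ g = Sum.elim (x ∘ g') (x ∘ h))
    (L : List C) (hL : ∀ i, i ∈ L) {X : QOp κ} (hX : X ∈ productCone f g') :
    Circuit.run (L.map fun i => Gate.meas (h i)) X ∈ productCone g f' := by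
  classical
  induction hX using AddSubmonoid.closure_induction with
  | mem X hX =>
    obtain ⟨α, β, hαβ⟩ := hX
    -- One term for each measurement outcome `c`: in $\alpha$ the communication qubits are frozen at
    -- `c`, and the indicator of `c` is attached to $\beta$, which thereby acquires these qubits.
    have h1 : Circuit.run (L.map fun i => Gate.meas (h i)) X = ∑ c : C → Bool,
        Matrix.of fun x y =>
          ((if x ∘ h = c then β (x ∘ g') else 0) * α (Sum.elim (x ∘ f') c)) *
          star ((if y ∘ h = c then β (y ∘ g') else 0) * α (Sum.elim (y ∘ f') c)) := by
      ext x y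
      rw [run_meas_list_apply, Matrix.sum_apply, Finset.sum_eq_single (x ∘ h), Matrix.of_apply,
        if_pos rfl]
      · have h2 : (∀ i ∈ L, x (h i) = y (h i)) ↔ y ∘ h = x ∘ h :=
          ⟨fun h3 => funext fun i => (h3 i (hL i)).symm, fun h3 i _ => (congrFun h3 i).symm⟩
        simp only [h2]
        split_ifs with h3
        · rw [hαβ, hf, hf, h3, mul_comm (α _), mul_comm (α _)]
        · rw [zero_mul, star_zero, mul_zero]
      · intro c _ hc
        rw [Matrix.of_apply, if_neg fun h => hc h.symm, zero_mul, zero_mul]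
      · simp
    rw [h1]
    refine sum_mem fun c _ => AddSubmonoid.subset_closure
      ⟨fun u => if u ∘ Sum.inr = c then β (u ∘ Sum.inl) else 0, fun u => α (Sum.elim u c),
        fun x y => ?_⟩
    simp only [hg, Sum.elim_comp_inl, Sum.elim_comp_inr]
    rfl
  | zero => rw [map_zero]; exact zero_mem _
  | add X Y _ _ h1 h2 => rw [map_add]; exact add_mem h1 h2

theorem smul_mem_schmidtCone {a b : Type} {k : ℕ} {X : Op (a × b)} (hX : X ∈ schmidtCone k a b)
    {r : ℝ} (hr : 0 ≤ r) : (r : ℂ) • X ∈ schmidtCone k a b := by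
  induction hX using AddSubmonoid.closure_induction with
  | mem X hX =>
    obtain ⟨U, W, h⟩ := hX
    refine AddSubmonoid.subset_closure ⟨fun i s => (√r : ℂ) * U i s, W, fun p q => ?_⟩
    have h1 : (r : ℂ) = √r * √r := by rw [← Complex.ofReal_mul, Real.mul_self_sqrt hr]
    simp only [Matrix.smul_apply, h, mul_assoc, ← Finset.mul_sum, star_mul', smul_eq_mul]
    rw [h1, Complex.star_def, Complex.conj_ofReal]
    ring
  | zero => rw [smul_zero]; exact zero_mem _
  | add X Y _ _ h1 h2 => rw [smul_add]; exact add_mem h1 h2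

/-- The amplitude `1` if all qubits are `0`, and `0` otherwise. -/
def allZero (u : κ → Bool) : ℂ := open Classical in if ∀ j, u j = false then 1 else 0

theorem offZero_inl (x : ι ⊕ κ → Bool) :
    offZero Function.Embedding.inl x = allZero (x ∘ Sum.inr) := by
  rw [offZero, allZero]
  congr 1
  simp [Sum.forall]

theorem extend_trans_inl (f : ι ↪ τ) (u : ι → Bool) (z : τ ⊕ κ → Bool) :
    Function.extend (f.trans Function.Embedding.inl) u z =
      Sum.elim (Function.extend f u (z ∘ Sum.inl)) (z ∘ Sum.inr) := by
  symm
  rw [eq_extend_iff]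
  constructor
  · exact extend_comp_emb f u (z ∘ Sum.inl)
  · rintro (j | j) hj
    · have := extend_apply_of_notMem f u (z ∘ Sum.inl) (j := j)
        fun ⟨i, hi⟩ => hj ⟨i, congrArg Sum.inl hi⟩
      exact this.symm
    · rfl

/-- Both factors split into rank-one terms. The communication qubits start at 0 and are counted with
the first party, who moves first. -/
theorem initReg_mem_productCone {ιA ιB : Type} [Fintype ιA] [Fintype ιB] (fA : ιA ↪ A)
    (fB : ιB ↪ B) {P : QOp ιA} {Q : QOp ιB} (hP : P.PosSemidef) (hQ : Q.PosSemidef)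
    {X : QOp (ιA ⊕ ιB)}
    (hX : ∀ x y, X x y = P (x ∘ Sum.inl) (y ∘ Sum.inl) * Q (x ∘ Sum.inr) (y ∘ Sum.inr)) :
    initReg ((Function.Embedding.sumMap fA fB).trans Function.Embedding.inl) X ∈
      productCone (withA A B C) (onlyB A B C) := by
  classical
  obtain ⟨U, hU⟩ := exists_sum_of_posSemidef hP
  obtain ⟨V, hV⟩ := exists_sum_of_posSemidef hQ
  let α : (ιA → Bool) → (A ⊕ C → Bool) → ℂ := fun k u =>
    allZero (u ∘ Sum.inr) * (offZero fA (u ∘ Sum.inl) * U k ((u ∘ Sum.inl) ∘ fA))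
  let β : (ιB → Bool) → (B → Bool) → ℂ := fun l u => offZero fB u * V l (u ∘ fB)
  have h : initReg ((Function.Embedding.sumMap fA fB).trans Function.Embedding.inl) X =
      ∑ k, ∑ l, Matrix.of fun x y : (A ⊕ B) ⊕ C → Bool =>
        (α k (x ∘ withA A B C) * β l (x ∘ onlyB A B C)) *
          star (α k (y ∘ withA A B C) * β l (y ∘ onlyB A B C)) := by
    ext x y
    simp only [initReg_apply_mul, offZero_trans, offZero_sumMap, offZero_inl, hX, hU, hV,
      Matrix.sum_apply, Matrix.of_apply, α, β, comp_withA, Sum.elim_comp_inr, Sum.elim_comp_inl]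
    rw [Finset.sum_mul_sum, Finset.mul_sum]
    refine Finset.sum_congr rfl fun k _ => ?_
    rw [Finset.mul_sum]
    refine Finset.sum_congr rfl fun l _ => ?_
    change _ * star (_ * (offZero fA (y ∘ onlyA A B C) * offZero fB (y ∘ onlyB A B C))) *
      (U k ((x ∘ onlyA A B C) ∘ fA) * star (U k ((y ∘ onlyA A B C) ∘ fA)) *
      (V l ((x ∘ onlyB A B C) ∘ fB) * star (V l ((y ∘ onlyB A B C) ∘ fB)))) = _
    change _ * (offZero fA (x ∘ onlyA A B C) * offZero fB (x ∘ onlyB A B C)) * _ * _ = _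
    simp only [star_mul']
    ring
  rw [h]
  exact sum_mem fun k _ => sum_mem fun l _ => AddSubmonoid.subset_closure
    ⟨α k, β l, fun x y => rfl⟩

/-- Fixing the discarded qubits of a product vector leaves a product vector, and the partial trace
is a nonnegative multiple of a sum of such terms. -/
theorem bip_reduceReg_mem_schmidtCone {ιA ιB : Type} [Fintype ιA] [Fintype ιB] [Fintype A]
    [Fintype B] [Fintype C] [DecidableEq ιA] [DecidableEq ιB] [DecidableEq A] [DecidableEq B]
    [DecidableEq C] (fA : ιA ↪ A) (fB : ιB ↪ B) {X : QOp ((A ⊕ B) ⊕ C)}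
    (hX : X ∈ productCone (withA A B C) (onlyB A B C)) :
    bip ιA ιB (reduceReg ((Function.Embedding.sumMap fA fB).trans Function.Embedding.inl) X) ∈
      schmidtCone 1 (ιA → Bool) (ιB → Bool) := by
  rw [reduceReg_eq_sum_slice, map_smul, map_sum,
    show ((2 : ℂ) ^ Fintype.card (ιA ⊕ ιB))⁻¹ = (((2 ^ Fintype.card (ιA ⊕ ιB))⁻¹ : ℝ) : ℂ) by
      push_cast; rfl]
  refine smul_mem_schmidtCone (sum_mem fun z _ => ?_) (by positivity)
  induction hX using AddSubmonoid.closure_induction with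
  | mem X hX =>
    obtain ⟨α, β, h⟩ := hX
    refine AddSubmonoid.subset_closure
      ⟨fun u _ => α (Sum.elim (Function.extend fA u (z ∘ onlyA A B C)) (z ∘ Sum.inr)),
       fun _ v => β (Function.extend fB v (z ∘ onlyB A B C)), fun p q => ?_⟩
    rw [bip_apply, slice_apply, h]
    simp only [extend_trans_inl, extend_sumMap, comp_withA, Finset.univ_unique, Finset.sum_const,
      Finset.card_singleton, one_smul]
    rfl
  | zero => rw [map_zero, map_zero]; exact zero_mem _
  | add X Y _ _ h1 h2 => rw [map_add, map_add]; exact add_mem h1 h2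

end Separable

/-! ### Circuit protocols on product states -/

section ProductInput

variable {nA nB m : ℕ}

/-- Invariant of a round: the communication qubits belong to Alice at its start, pass to Bob after
the first measurement, and return to Alice after the second. -/
theorem LOCCCircuit.run_circuit_mem_productCone (Γ : LOCCCircuit nA nB m m) {X : QOp Γ.Reg}
    (hX : X ∈ productCone (withA _ _ _) (onlyB _ _ _)) :
    Circuit.run Γ.circuit X ∈ productCone (withA _ _ _) (onlyB _ _ _) := by
  rw [LOCCCircuit.circuit]
  generalize List.finRange Γ.r = L
  induction L generalizing X with
  | nil => exact hX
  | cons i L ih =>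
    rw [List.flatMap_cons, run_append]
    refine ih ?_
    rw [run_append, run_append, run_append]
    have h1 := run_map_mem_productCone withA_ne_onlyB (Γ.circA i) hX
    have h2 := run_meas_mem_productCone (h := Function.Embedding.inr) comp_withA comp_withB
      (List.finRange Γ.c) List.mem_finRange h1
    have h3 := run_map_mem_productCone withB_ne_onlyA (Γ.circB i) h2
    exact run_meas_mem_productCone (h := Function.Embedding.inr) comp_withB comp_withA
      (List.finRange Γ.c) List.mem_finRange h3

/-- No circuit protocol generates entanglement from a product state. -/
theorem LOCCCircuit.le_pErr_of_product (Γ : LOCCCircuit nA nB m m) {P : QOp (Fin nA)}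
    {Q : QOp (Fin nB)} (hP : IsDensity P) (hQ : IsDensity Q) {ρ : QOp (Fin nA ⊕ Fin nB)}
    (hρ : ∀ x y, ρ x y = P (x ∘ Sum.inl) (y ∘ Sum.inl) * Q (x ∘ Sum.inr) (y ∘ Sum.inr)) :
    1 - (2 : ℝ)⁻¹ ^ m ≤ pErr Γ.run ρ := by
  have h1 : bip (Fin m) (Fin m) (Γ.run ρ) ∈ schmidtCone 1 _ _ :=
    bip_reduceReg_mem_schmidtCone (Fin.castLEEmb Γ.hA) (Fin.castLEEmb Γ.hB)
      (Γ.run_circuit_mem_productCone (initReg_mem_productCone _ _ hP.1 hQ.1 hρ))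
  have h2 : (Γ.run ρ).trace = 1 := by
    change (reduceReg _ (Circuit.run _ (initReg _ ρ))).trace = 1
    rw [trace_reduceReg, trace_run, trace_initReg, Matrix.trace]
    simp only [Matrix.diag, hρ]
    rw [sum_sum_elim, Fintype.sum_prod_type]
    simp only [Sum.elim_comp_inl, Sum.elim_comp_inr]
    rw [← Finset.sum_mul_sum]
    exact (congrArg₂ (· * ·) hP.2 hQ.2).trans (one_mul 1)
  have h3 := re_maxEntOverlap_le h1
  rw [trace_bip, h2, Complex.one_re, Nat.cast_one, one_mul] at h3
  rw [pErr_eq, one_div]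
  have h4 : (0 : ℝ) ≤ 2⁻¹ ^ m := by positivity
  have := mul_le_mul_of_nonneg_left h3 h4
  linarith

/-- Discarding the input and emitting `σ` destroys all correlations: the result is the reduced state
on `A` tensored with `σ`. -/
theorem onB_smulRight_trace_apply {n l : ℕ} (σ : QOp (Fin l)) (X : QOp (Fin n ⊕ Fin n))
    (x y : Fin n ⊕ Fin l → Bool) :
    onB (Fin n) ((Matrix.traceLinearMap (Fin n → Bool) ℂ ℂ).smulRight σ) X x y =
      reduceReg Function.Embedding.inl X (x ∘ Sum.inl) (y ∘ Sum.inl) *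
        σ (x ∘ Sum.inr) (y ∘ Sum.inr) := by
  have h : ∀ (a : Fin n → Bool) (z : Fin n ⊕ Fin n → Bool),
      Function.extend (Function.Embedding.inl : Fin n ↪ Fin n ⊕ Fin n) a z =
        Sum.elim a (z ∘ Sum.inr) := by
    intro a z
    have := extend_trans_inl (Function.Embedding.refl (Fin n)) a z
    rwa [extend_refl] at this
  rw [onB_apply, reduceReg_apply, sum_sum_elim, Fintype.sum_prod_type]
  simp only [h, Sum.elim_comp_inr, Finset.sum_const, Finset.card_univ, Fintype.card_fun,
    Fintype.card_bool, nsmul_eq_mul, Nat.cast_pow, Nat.cast_ofNat]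
  rw [inv_mul_cancel_left₀ (pow_ne_zero _ two_ne_zero)]
  rfl

end ProductInput

/-! ### Classical circuits -/

section Classical

variable {ι κ : Type} [DecidableEq ι] [Fintype ι] [DecidableEq κ] [Fintype κ]

/-- The action of a classical circuit on the computational basis. -/
def Circuit.eval : Circuit ι → (ι → Bool) → (ι → Bool)
  | [], x => x
  | g :: c, x => Circuit.eval c (g.perm x)

theorem eval_append (c d : Circuit ι) (x : ι → Bool) :
    Circuit.eval (c ++ d) x = Circuit.eval d (Circuit.eval c x) := by
  induction c generalizing x with
  | nil => rfl
  | cons g c ih => exact ih (g.perm x)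

theorem eval_map_extend (f : ι ↪ κ) (c : Circuit ι) (u : ι → Bool) (x : κ → Bool) :
    Circuit.eval (c.map (Gate.map f)) (Function.extend f u x) =
      Function.extend f (Circuit.eval c u) x := by
  induction c generalizing u with
  | nil => rfl
  | cons g c ih =>
    change Circuit.eval (c.map (Gate.map f)) ((g.map f).perm (Function.extend f u x)) = _
    rw [Gate.perm_map_extend, ih]
    rfl

theorem eval_map (f : ι ↪ κ) (c : Circuit ι) (x : κ → Bool) :
    Circuit.eval (c.map (Gate.map f)) x = Function.extend f (Circuit.eval c (x ∘ f)) x := by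
  rw [← eval_map_extend, extend_comp_self]

theorem Gate.IsClassical.map {g : Gate ι} (hg : g.IsClassical) (f : ι ↪ κ) :
    (g.map f).IsClassical := by
  cases g <;> exact hg

/-- A classical circuit permutes diagonal entries, so testing `P` at the end amounts to testing `P`
of the evaluated string at the start. -/
theorem sum_ite_run_classical {c : Circuit ι} (hc : ∀ g ∈ c, g.IsClassical)
    (P : (ι → Bool) → Bool) (X : QOp ι) :
    ∑ x, (if P x then Circuit.run c X x x else 0) =
      ∑ x, if P (Circuit.eval c x) then X x x else 0 := by
  induction c generalizing X with
  | nil => rfl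
  | cons g c ih =>
    change ∑ x, (if P x then Circuit.run c (g.run X) x x else 0) =
      ∑ x, if P (Circuit.eval c (g.perm x)) then X x x else 0
    rw [ih fun g' hg' => hc g' (by simp [hg'])]
    simp only [Gate.run_classical_apply (hc g (by simp))]
    rw [← Equiv.sum_comp (Function.Involutive.toPerm g.perm g.perm_involutive)]
    refine Finset.sum_congr rfl fun x _ => ?_
    simp only [Function.Involutive.coe_toPerm, g.perm_involutive x]

/-- Discarding other qubits does not change the outcome distribution of a kept one. -/
theorem sum_ite_reduceReg (f : ι ↪ κ) (i : ι) (X : QOp κ) :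
    ∑ u, (if u i then reduceReg f X u u else 0) = ∑ x, if x (f i) then X x x else 0 := by
  have h2 : (2 : ℂ) ^ Fintype.card ι ≠ 0 := pow_ne_zero _ two_ne_zero
  have h := sum_sum_extend f fun x => if x (f i) then X x x else 0
  rw [eq_comm, ← eq_inv_mul_iff_mul_eq₀ h2] at h
  rw [h, Finset.sum_comm, Finset.mul_sum]
  refine Finset.sum_congr rfl fun u _ => ?_
  simp only [extend_apply_emb, reduceReg_apply]
  split_ifs
  · rfl
  · simp

end Classical

/-! ### Testing for the maximally entangled state -/

section Test

/-- The circuit that computes in the last of `k + 1` ancillas whether all of `k` qubits are `0`. -/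
def andCircuit : (k : ℕ) → Circuit (Fin k ⊕ Fin (k + 1))
  | 0 => [.x (Sum.inr 0)]
  | k + 1 => (andCircuit k).map
      (Gate.map (Function.Embedding.sumMap Fin.castSuccEmb Fin.castSuccEmb)) ++
      [.x (Sum.inl (Fin.last k)), .toffoli (Sum.inl (Fin.last k)) (Sum.inr (Fin.last k).castSucc)
        (Sum.inr (Fin.last (k + 1))) Sum.inl_ne_inr Sum.inl_ne_inr
        (Sum.inr_injective.ne (Fin.castSucc_lt_last _).ne)]

theorem andCircuit_length (k : ℕ) : (andCircuit k).length = 2 * k + 1 := by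
  induction k with
  | zero => rfl
  | succ k ih => simp [andCircuit, ih]; ring

theorem andCircuit_isClassical (k : ℕ) : ∀ g ∈ andCircuit k, g.IsClassical := by
  induction k with
  | zero =>
    intro g hg
    rw [andCircuit, List.mem_singleton] at hg
    subst hg
    trivial
  | succ k ih =>
    intro g hg
    simp only [andCircuit, List.mem_append, List.mem_map, List.mem_cons, List.not_mem_nil,
      or_false] at hg
    obtain ⟨g', hg', rfl⟩ | rfl | rfl := hg
    · exact (ih g' hg').map _
    · trivial
    · trivial

/-- Ancilla `j` holds the conjunction of the negations of the first `j` qubits, starting from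
ancilla 0 flipped to 1. The input qubits stay negated, which is harmless since only the last ancilla
is read. -/
theorem andCircuit_eval (k : ℕ) (x : Fin k ⊕ Fin (k + 1) → Bool)
    (hx : ∀ j, x (Sum.inr j) = false) :
    Circuit.eval (andCircuit k) x (Sum.inr (Fin.last k)) = decide (∀ i, x (Sum.inl i) = false) := by
  induction k with
  | zero =>
    simp [andCircuit, Circuit.eval, Gate.perm, hx]
  | succ k ih =>
    rw [andCircuit, eval_append, eval_map, extend_sumMap]
    have h := ih (x ∘ Function.Embedding.sumMap Fin.castSuccEmb Fin.castSuccEmb)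
      fun j => hx j.castSucc
    set y := Circuit.eval (andCircuit k)
      (x ∘ Function.Embedding.sumMap Fin.castSuccEmb Fin.castSuccEmb)
    have h1 : Function.extend (Fin.castSuccEmb (n := k)) (y ∘ Sum.inl) (x ∘ Sum.inl)
        (Fin.last k) = x (Sum.inl (Fin.last k)) :=
      extend_apply_of_notMem _ _ _ fun ⟨i, hi⟩ => (Fin.castSucc_lt_last i).ne hi
    have h2 : Function.extend (Fin.castSuccEmb (n := k + 1)) (y ∘ Sum.inr) (x ∘ Sum.inr)
        (Fin.last (k + 1)) = false :=
      (extend_apply_of_notMem _ _ _ fun ⟨i, hi⟩ => (Fin.castSucc_lt_last i).ne hi).trans (hx _)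
    have h3 : Function.extend (Fin.castSuccEmb (n := k + 1)) (y ∘ Sum.inr) (x ∘ Sum.inr)
        (Fin.last k).castSucc = decide (∀ i : Fin k, x (Sum.inl i.castSucc) = false) :=
      (extend_apply_emb _ _ _ _).trans h
    simp only [Circuit.eval, Gate.perm, Function.update_self, ne_eq, reduceCtorEq,
      not_false_eq_true, Function.update_of_ne, Sum.elim_inl, Sum.elim_inr, h1, h2, h3,
      Bool.false_xor, Fin.forall_fin_succ']
    cases x (Sum.inl (Fin.last k)) <;> simp

/-- The circuit that tests `m + m` qubits for the state `|Φ⟩^{⊗ m}`, the result being written to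
the last of `m + m + 1` ancillas. -/
def testCircuit (m : ℕ) : Circuit ((Fin m ⊕ Fin m) ⊕ Fin (m + m + 1)) :=
  (eprCircuit m).reverse.map (Gate.map Function.Embedding.inl) ++
    (andCircuit (m + m)).map (Gate.map (Function.Embedding.sumMap
      finSumFinEquiv.symm.toEmbedding (Function.Embedding.refl _)))

theorem testCircuit_length (m : ℕ) : (testCircuit m).length = 6 * m + 1 := by
  simp [testCircuit, eprCircuit_length, andCircuit_length]
  ring

theorem trace_mul_zeroState {ι : Type} [Fintype ι] [DecidableEq ι] (X : QOp ι) :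
    (X * zeroState ι).trace = X (fun _ => false) (fun _ => false) := by
  have h : ∀ x : ι → Bool, (∀ i, x i = false) ↔ x = fun _ => false :=
    fun x => ⟨funext, fun h i => by rw [h]⟩
  simp only [Matrix.trace, Matrix.diag, Matrix.mul_apply, zeroState, Matrix.of_apply, h, ite_and]
  simp

theorem sum_testCircuit (m : ℕ) (R : QOp (Fin m ⊕ Fin m)) :
    ∑ x, (if x (Sum.inr (Fin.last (m + m))) then
        Circuit.run (testCircuit m) (initReg Function.Embedding.inl R) x x else 0) =
      star (eprVec m) ⬝ᵥ (R *ᵥ eprVec m) := by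
  set R' := Circuit.run (eprCircuit m).reverse R with hR'
  have h1 : R' (fun _ => false) (fun _ => false) = star (eprVec m) ⬝ᵥ (R *ᵥ eprVec m) := by
    refine (trace_mul_zeroState R').symm.trans ?_
    -- The all-zero entry after the reversed preparation equals the overlap of `R` with the prepared
    -- EPR state.
    rw [hR', trace_run_mul (eprCircuit_noT m), run_eprCircuit,
      trace_mul_epr]
  rw [← h1, testCircuit, run_append, run_map_initReg, ← hR']
  rw [sum_ite_run_classical (P := fun x => x (Sum.inr (Fin.last (m + m))))]
  · simp only [initReg_apply_mul, offZero_inl]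
    rw [sum_sum_elim, Fintype.sum_prod_type, Finset.sum_eq_single (fun _ => false),
      Finset.sum_eq_single (fun _ => false)]
    all_goals simp only [eval_map, extend_sumMap, extend_refl, Sum.elim_inr, Sum.elim_comp_inr,
      Function.comp_apply]
    · rw [andCircuit_eval _ _ fun j => rfl]
      simp [allZero, Function.comp_def]
    · intro v _ hv
      have : allZero v = 0 := by
        rw [allZero, if_neg]
        exact fun h => hv (funext h)
      rw [this, zero_mul, zero_mul, ite_self]
    · simp
    · intro u _ hu
      refine Finset.sum_eq_zero fun v _ => ?_
      by_cases hv : ∀ j, v j = false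
      · rw [andCircuit_eval _ _ hv, if_neg]
        rw [decide_eq_true_eq]
        intro h
        refine hu (funext fun i => ?_)
        have := h (finSumFinEquiv i)
        simpa using this
      · rw [allZero, if_neg hv, zero_mul, zero_mul, ite_self]
    · simp
  · intro g hg
    obtain ⟨g', hg', rfl⟩ := List.mem_map.1 hg
    exact (andCircuit_isClassical _ g' hg').map _

theorem reduceReg_sumMap_initReg_inl {ι κ τ : Type} [Fintype ι] [Fintype κ] [Fintype τ]
    [DecidableEq ι] [DecidableEq κ] [DecidableEq τ] (f : ι ↪ κ) (X : QOp κ) :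
    reduceReg (Function.Embedding.sumMap f (Function.Embedding.refl τ))
      (initReg Function.Embedding.inl X) = initReg Function.Embedding.inl (reduceReg f X) := by
  ext u v
  have h : ∀ z : κ ⊕ τ → Bool, initReg Function.Embedding.inl X
      (Function.extend (Function.Embedding.sumMap f (Function.Embedding.refl τ)) u z)
      (Function.extend (Function.Embedding.sumMap f (Function.Embedding.refl τ)) v z) =
      (allZero (u ∘ Sum.inr) * star (allZero (v ∘ Sum.inr))) *
        X (Function.extend f (u ∘ Sum.inl) (z ∘ Sum.inl))
          (Function.extend f (v ∘ Sum.inl) (z ∘ Sum.inl)) := by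
    intro z
    rw [initReg_apply_mul, extend_sumMap, extend_sumMap, extend_refl, extend_refl, offZero_inl,
      offZero_inl]
    rfl
  rw [reduceReg_apply, initReg_apply_mul, reduceReg_apply, offZero_inl, offZero_inl]
  simp only [h]
  rw [← Finset.mul_sum, sum_sum_elim, Fintype.sum_prod_type]
  simp only [Sum.elim_comp_inl, Finset.sum_const, Finset.card_univ, Fintype.card_sum,
    Fintype.card_fun, Fintype.card_bool, nsmul_eq_mul, pow_add, Nat.cast_pow, Nat.cast_ofNat,
    ← Finset.mul_sum]
  have h3 : (2 : ℂ) ^ Fintype.card τ ≠ 0 := pow_ne_zero _ two_ne_zero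
  rw [mul_inv, mul_left_comm (allZero _ * _), ← mul_assoc, inv_mul_cancel_right₀ h3,
    mul_left_comm]
  rfl

end Test

/-! ### Distillation protocols as distinguishers -/

section Distinguisher

/-- Rearrangement of qubits: those in `L` are set apart. -/
def shuffle (A L B C T : Type) : (((A ⊕ (L ⊕ B)) ⊕ C) ⊕ T) ↪ (((A ⊕ (B ⊕ C)) ⊕ T) ⊕ L) where
  toFun
    | .inl (.inl (.inl a)) => .inl (.inl (.inl a))
    | .inl (.inl (.inr (.inl l))) => .inr l
    | .inl (.inl (.inr (.inr b))) => .inl (.inl (.inr (.inl b)))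
    | .inl (.inr c) => .inl (.inl (.inr (.inr c)))
    | .inr t => .inl (.inr t)
  inj' := by
    rintro (((a | (l | b)) | c) | t) (((a' | (l' | b')) | c') | t') h <;> simp_all

theorem exists_equiv_fin_apply_eq_zero {K : Type} [Fintype K] {w : ℕ}
    (hK : Fintype.card K = w + 1) (k : K) : ∃ e : K ≃ Fin (w + 1), e k = 0 := by
  let e := Fintype.equivFinOfCardEq hK
  exact ⟨e.trans (Equiv.swap (e k) 0), by simp⟩

/-- A distillation protocol yields an algorithm with access to a channel that accepts with
probability the fidelity of the protocol on EPR pairs sent through the channel. -/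
theorem exists_oracleCircuit {n l m : ℕ} (Γ : LOCCCircuit n l m m) :
    ∃ 𝒜 : OracleCircuit n l, 𝒜.size = 4 * n + Γ.size + 8 * m + l + 4 ∧
      ∀ O, 𝒜.acceptProb O = 1 - pErr Γ.run (onB (Fin n) O (epr n)) := by
  -- The memory holds every qubit of the protocol and the test except Bob's `l` input qubits, which
  -- are the oracle's answer. Its labelling places the result of the test at memory qubit 0.
  let K := (Fin (n + Γ.tA) ⊕ (Fin Γ.tB ⊕ Fin Γ.c)) ⊕ Fin (m + m + 1)
  obtain ⟨e, he⟩ := exists_equiv_fin_apply_eq_zero (K := K)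
    (w := n + Γ.tA + (Γ.tB + Γ.c) + (m + m)) (by simp [K]; ring) (Sum.inr (Fin.last (m + m)))
  let a : Fin n ↪ Fin (n + Γ.tA + (Γ.tB + Γ.c) + (m + m) + 1) :=
    (Fin.castAddEmb Γ.tA).trans
      (Function.Embedding.inl.trans (Function.Embedding.inl.trans e.toEmbedding))
  let h : (Fin m ⊕ Fin m) ⊕ Fin (m + m + 1) ↪ Γ.Reg ⊕ Fin (m + m + 1) :=
    Function.Embedding.sumMap Γ.out (Function.Embedding.refl _)
  obtain ⟨F, hF, hF0⟩ : ∃ F : Γ.Reg ⊕ Fin (m + m + 1) ↪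
      Fin (n + Γ.tA + (Γ.tB + Γ.c) + (m + m) + 1) ⊕ Fin l,
      (Γ.inp.trans Function.Embedding.inl).trans F =
        Function.Embedding.sumMap a (Function.Embedding.refl (Fin l)) ∧
      F (h (Sum.inr (Fin.last (m + m)))) = Sum.inl 0 := by
    refine ⟨(Equiv.sumCongr (Equiv.sumCongr (Equiv.sumCongr (Equiv.refl _) finSumFinEquiv.symm)
      (Equiv.refl _)) (Equiv.refl _)).toEmbedding.trans
      ((shuffle (Fin (n + Γ.tA)) (Fin l) (Fin Γ.tB) (Fin Γ.c) (Fin (m + m + 1))).trans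
        (Equiv.sumCongr e (Equiv.refl _)).toEmbedding), ?_, congrArg Sum.inl he⟩
    ext (i | i) : 1
    · rfl
    · change Sum.map e id (shuffle _ _ _ _ _ (Sum.inl (Sum.inl (Sum.inr
        (finSumFinEquiv.symm (Fin.castAdd Γ.tB i)))))) = _
      rw [finSumFinEquiv_symm_apply_castAdd]
      rfl
  let 𝒜 : OracleCircuit n l :=
    { w := n + Γ.tA + (Γ.tB + Γ.c) + (m + m)
      q := 1
      pre := fun _ => (eprCircuit n).map
        (Gate.map (Function.Embedding.sumMap a (Function.Embedding.refl _)))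
      post := fun _ => (Γ.circuit.map (Gate.map Function.Embedding.inl) ++
        (testCircuit m).map (Gate.map h)).map (Gate.map F) }
  refine ⟨𝒜, ?_, fun O => ?_⟩
  · simp only [𝒜, OracleCircuit.size, LOCCCircuit.size, List.length_map, List.length_append,
      eprCircuit_length, testCircuit_length, Finset.univ_unique, Finset.sum_const,
      Finset.card_singleton, one_smul]
    ring
  · set ρ := onB (Fin n) O (epr n) with hρ
    have h1 : 𝒜.finalState O = reduceReg Function.Embedding.inl (initReg F (Circuit.run
        ((testCircuit m).map (Gate.map h)) (initReg Function.Embedding.inl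
          (Circuit.run Γ.circuit (initReg Γ.inp ρ))))) := by
      change reduceReg _ (Circuit.run _ (onB _ O (Circuit.run _ (initReg _ (zeroState _))))) = _
      rw [initReg_zeroState, ← initReg_zeroState
        (Function.Embedding.sumMap a (Function.Embedding.refl _)), run_map_initReg,
        run_eprCircuit, onB_initReg_sumMap, ← hρ, ← hF, initReg_trans, initReg_trans,
        run_map_initReg, run_append, run_map_initReg]
    have h2 : 𝒜.acceptProb O = (∑ x : Fin (𝒜.w + 1) → Bool,
        if x 0 then 𝒜.finalState O x x else 0).re := by
      rw [OracleCircuit.acceptProb, Complex.re_sum]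
      refine Finset.sum_congr rfl fun x _ => ?_
      split_ifs <;> rfl
    rw [h2, h1]
    -- Acceptance depends on one qubit only, so the bookkeeping register can be exchanged for the
    -- protocol register, and that one for its output qubits together with the test ancillas.
    rw [sum_ite_reduceReg, show Function.Embedding.inl 0 = F (h (Sum.inr (Fin.last (m + m)))) from
      hF0.symm, ← sum_ite_reduceReg, reduceReg_initReg, ← sum_ite_reduceReg, reduceReg_run_map,
      reduceReg_sumMap_initReg_inl, sum_testCircuit, pErr, sub_sub_cancel]
    rfl

end Distinguisher

/-! ### Polynomially bounded and negligible functions -/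

section Asymptotics

theorem eval_le_eval_nat (p : Polynomial ℕ) {x y : ℕ} (h : x ≤ y) : p.eval x ≤ p.eval y := by
  rw [Polynomial.eval_eq_sum_range, Polynomial.eval_eq_sum_range]
  gcongr

theorem PolyBounded.mono {f g : ℕ+ → ℕ} (hg : PolyBounded g) (h : ∀ lam, f lam ≤ g lam) :
    PolyBounded f :=
  let ⟨p, hp⟩ := hg
  ⟨p, fun lam => (h lam).trans (hp lam)⟩

theorem PolyBounded.add {f g : ℕ+ → ℕ} (hf : PolyBounded f) (hg : PolyBounded g) :
    PolyBounded fun lam => f lam + g lam :=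
  let ⟨p, hp⟩ := hf
  let ⟨q, hq⟩ := hg
  ⟨p + q, fun lam => by rw [Polynomial.eval_add]; exact add_le_add (hp lam) (hq lam)⟩

theorem PolyBounded.const_mul {f : ℕ+ → ℕ} (k : ℕ) (hf : PolyBounded f) :
    PolyBounded fun lam => k * f lam :=
  let ⟨p, hp⟩ := hf
  ⟨Polynomial.C k * p, fun lam => by
    rw [Polynomial.eval_mul, Polynomial.eval_C]; exact Nat.mul_le_mul_left k (hp lam)⟩

theorem polyBounded_const (k : ℕ) : PolyBounded fun _ => k :=
  ⟨Polynomial.C k, fun lam => by rw [Polynomial.eval_C]⟩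

theorem PolyBounded.eval_add_comp {f : ℕ+ → ℕ} (p : Polynomial ℕ) (hf : PolyBounded f) :
    PolyBounded fun lam => p.eval ((lam : ℕ) + f lam) :=
  let ⟨q, hq⟩ := hf
  ⟨p.comp (Polynomial.X + q), fun lam => by
    rw [Polynomial.eval_comp, Polynomial.eval_add, Polynomial.eval_X]
    exact eval_le_eval_nat p (Nat.add_le_add_left (hq lam) _)⟩

theorem Negligible.mono {f g : ℕ+ → ℝ} (hg : Negligible g) (h : ∀ lam, |f lam| ≤ |g lam|) :
    Negligible f := fun p => by
  refine squeeze_zero_norm (fun lam => ?_) (by simpa using (hg p).norm)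
  rw [Real.norm_eq_abs, abs_mul]
  exact mul_le_mul_of_nonneg_left (h lam) (abs_nonneg _)

/-- The polynomial bound on `m` is absorbed into the test polynomial. -/
theorem Negligible.polyBounded_mul {f : ℕ+ → ℝ} (hf : Negligible f) {m : ℕ+ → ℕ}
    (hm : PolyBounded m) : Negligible fun lam => m lam * f lam := fun p => by
  obtain ⟨q, hq⟩ := hm
  have h := (hf (p * q.map (Nat.castRingHom ℝ))).norm
  refine squeeze_zero_norm (fun lam => ?_) (by simpa using h)
  change |_ * (_ * _)| ≤ _
  rw [abs_mul, abs_mul, Nat.abs_cast, ← mul_assoc]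
  have := hq lam
  gcongr

end Asymptotics

/-! ### The state of a commitment scheme -/

namespace CommitmentFamily

variable {S : CommitmentFamily} {n : ℕ+ → ℕ}

theorem isDensity_state (lam : ℕ+) : IsDensity (S.state n lam) := by
  obtain ⟨d, -, hd⟩ := exists_channelCircuit_onB_epr (S.circ lam (n lam))
  rw [show S.state n lam = d.run (zeroState (Fin 0)) from hd.symm]
  exact isDensity_channelCircuit_run d isDensity_zeroState

theorem IsNISBQ.polyBounded_size (hS : S.IsNISBQ) (hn : PolyBounded n) :
    PolyBounded fun lam => (S.circ lam (n lam)).size :=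
  let ⟨p, hp⟩ := hS.efficient
  (hn.eval_add_comp p).mono fun lam => hp lam (n lam)

theorem IsNISBQ.polyBounded_outLen (hS : S.IsNISBQ) (hn : PolyBounded n) :
    PolyBounded fun lam => S.outLen lam (n lam) := by
  refine (hn.add (hS.polyBounded_size hn)).mono fun lam => ?_
  -- The output qubits are chosen among inputs and ancillas, and ancillas count towards the size.
  have h := Fintype.card_le_of_embedding (S.circ lam (n lam)).out
  simp only [Fintype.card_fin, Fintype.card_sum] at h
  exact h.trans (Nat.add_le_add_left (Nat.le_add_right _ _) _)

theorem IsNISBQ.efficientlyPreparable (hS : S.IsNISBQ) (hn : PolyBounded n) :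
    EfficientlyPreparable (S.state n) := by
  choose d hd1 hd2 using fun lam => exists_channelCircuit_onB_epr (S.circ lam (n lam))
  refine ⟨d, ?_, hd2⟩
  simp only [hd1]
  exact (hn.const_mul 4).add (hS.polyBounded_size hn)

theorem IsNISBQ.exists_distillable (hS : S.IsNISBQ) (hn : PolyBounded n) :
    ∃ δ : ℕ+ → ℝ, Negligible δ ∧ (∀ lam, δ lam ∈ Set.Icc (0 : ℝ) 1) ∧
      (∀ lam, (n lam : ℕ∞) ≤ distillable (δ lam) (S.state n lam)) ∧
      ∀ᶠ lam in atTop, distillable (δ lam) (S.state n lam) = (n lam : ℕ∞) := by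
  obtain ⟨D, hD, h⟩ := hS.binding
  obtain ⟨δ, hδ, hδD⟩ := h n hn
  have hneg : Negligible fun lam => min 1 (max 0 (δ lam)) := hδ.mono fun lam => by
    rw [abs_of_nonneg (le_min zero_le_one (le_max_left _ _))]
    exact (min_le_right _ _).trans (max_le (abs_nonneg _) (le_abs_self _))
  have hle : ∀ lam, (n lam : ℕ∞) ≤ distillable (min 1 (max 0 (δ lam))) (S.state n lam) :=
    fun lam => le_distillable_of_channel (hD lam (n lam)) (hδD lam) (isDensity_state lam)
  refine ⟨_, hneg, fun lam => ⟨le_min zero_le_one (le_max_left _ _), min_le_left _ _⟩, hle, ?_⟩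
  -- Negligibility tested on the constant polynomial 1 brings the error below `1 / 2` eventually,
  -- where the upper bound applies.
  have h1 : Tendsto (fun lam => min 1 (max 0 (δ lam))) atTop (𝓝 0) := by
    simpa using hneg 1
  filter_upwards [h1.eventually_lt_const (show (0 : ℝ) < 1 / 2 by norm_num)] with lam hlam
  exact (distillable_le (isDensity_state lam) hlam).antisymm (hle lam)

/-- A computational distillation protocol does not perform noticeably better on the state of the
commitment scheme than on a product state. -/
theorem IsNISBQ.exists_negligible (hS : S.IsNISBQ) (hn : PolyBounded n) {m : ℕ+ → ℕ}
    {ε : ℕ+ → ℝ} (h : CompDistillableGE ε (S.state n) m) :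
    PolyBounded m ∧ ∃ η : ℕ+ → ℝ, Negligible η ∧ (∀ lam, 0 ≤ η lam) ∧
      ∀ lam, 1 - ε lam - (2 : ℝ)⁻¹ ^ m lam ≤ η lam := by
  obtain ⟨Γ, hΓ, herr⟩ := h
  have hm : PolyBounded m := (hn.add hΓ).mono fun lam => by
    refine (Γ lam).hA.trans (Nat.add_le_add_left ?_ _)
    rw [LOCCCircuit.size]
    omega
  choose 𝒜 h𝒜 hacc using fun lam => exists_oracleCircuit (Γ lam)
  have hsize : PolyBounded fun lam => (𝒜 lam).size := by
    simp only [h𝒜]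
    exact ((((hn.const_mul 4).add hΓ).add (hm.const_mul 8)).add (hS.polyBounded_outLen hn)).add
      (polyBounded_const 4)
  -- The witness `η` is the advantage of the distinguisher built from the protocol.
  refine ⟨hm, _, hS.indistinguishable n hn 𝒜 hsize, fun _ => abs_nonneg _, fun lam => ?_⟩
  have h1 : (2 : ℝ)⁻¹ ^ m lam ≥ (𝒜 lam).acceptProb (S.C0 lam (n lam)) := by
    rw [hacc]
    have hepr := isDensity_epr (n lam)
    have := (Γ lam).le_pErr_of_product
      (P := reduceReg Function.Embedding.inl (epr (n lam)))
      (Q := S.C lam (n lam) (zeroState (Fin (n lam))))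
      ⟨posSemidef_reduceReg _ hepr.1, by rw [trace_reduceReg, hepr.2]⟩
      (isDensity_channelCircuit_run _ isDensity_zeroState)
      (ρ := onB (Fin (n lam)) (S.C0 lam (n lam)) (epr (n lam)))
      (onB_smulRight_trace_apply _ _)
    linarith
  have h2 : 1 - ε lam ≤ (𝒜 lam).acceptProb (S.C lam (n lam)) := by
    rw [hacc]
    exact sub_le_sub_left (herr lam) 1
  have h3 := le_abs_self ((𝒜 lam).acceptProb (S.C lam (n lam)) -
    (𝒜 lam).acceptProb (S.C0 lam (n lam)))
  linarith

end CommitmentFamily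

end CompEnt

end

theorem mainTheorem3 (S : CompEnt.CommitmentFamily) (hS : S.IsNISBQ)
    (n : ℕ+ → ℕ) (hn : CompEnt.PolyBounded n) :
    -- the family consists of efficiently preparable states
    (∀ lam, CompEnt.IsDensity (S.state n lam)) ∧
    CompEnt.EfficientlyPreparable (S.state n) ∧
    -- the information-theoretic distillable entanglement is `n`
    (∃ δ : ℕ+ → ℝ, CompEnt.Negligible δ ∧ (∀ lam, δ lam ∈ Set.Icc (0 : ℝ) 1) ∧
      (∀ lam, (n lam : ℕ∞) ≤ CompEnt.distillable (δ lam) (S.state n lam)) ∧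
      (∀ᶠ lam in Filter.atTop,
        CompEnt.distillable (δ lam) (S.state n lam) = (n lam : ℕ∞))) ∧
    (∀ (lam : ℕ+) (ε : ℝ), ε < 1 / 2 →
      CompEnt.distillable ε (S.state n lam) ≤ (n lam : ℕ∞)) ∧
    -- the computational distillable entanglement
    (∀ (m : ℕ+ → ℕ) (ε : ℕ+ → ℝ), (∀ lam, ε lam ∈ Set.Icc (0 : ℝ) 1) →
      CompEnt.CompDistillableGE ε (S.state n) m →
      (∃ δ : ℕ+ → ℝ, CompEnt.Negligible δ ∧
        ∀ lam, (m lam : ℝ) * (1 - ε lam - (2 : ℝ)⁻¹ ^ m lam) ≤ δ lam) ∧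
      (∀ p : Polynomial ℝ, (∀ lam : ℕ+, 0 < p.eval ((lam : ℕ) : ℝ)) →
        (∀ᶠ lam : ℕ+ in Filter.atTop, 0 < m lam →
          (2 : ℝ)⁻¹ ^ m lam + 1 / p.eval ((lam : ℕ) : ℝ) ≤ 1 - ε lam) →
        CompEnt.AsympLE m (fun _ => 0))) := by
  refine ⟨fun lam => CompEnt.CommitmentFamily.isDensity_state lam, hS.efficientlyPreparable hn,
    hS.exists_distillable hn,
    fun lam ε hε => CompEnt.distillable_le (CompEnt.CommitmentFamily.isDensity_state lam) hε,
    fun m ε _ hm => ?_⟩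
  obtain ⟨hpoly, η, hη, hη0, hle⟩ := hS.exists_negligible hn hm
  refine ⟨⟨_, hη.polyBounded_mul hpoly, fun lam =>
    mul_le_mul_of_nonneg_left (hle lam) (Nat.cast_nonneg _)⟩, fun p hp hev => ?_⟩
  -- Negligibility is tested on `p` itself: eventually $p\,\eta<1$, whereas a positive `m lam` would
  -- force $1/p\le\eta$.
  obtain ⟨lam₀, h⟩ := Filter.eventually_atTop.1
    (hev.and ((hη p).eventually_lt_const (zero_lt_one' ℝ)))
  refine ⟨lam₀, fun lam hlam => ?_⟩
  obtain ⟨h1, h2⟩ := h lam hlam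
  by_contra! hpos
  have h3 : 1 / p.eval ((lam : ℕ) : ℝ) ≤ η lam := by linarith [h1 hpos, hle lam]
  rw [div_le_iff₀' (hp lam)] at h3
  linarith
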